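/- \textbf{Conventions.} A signature is a finite set $L$ of relation symbols, each of positive finite arity. For a finite set $D$ (possibly empty), $\Omega^L_D$ is the finite set of $L$-structures (``worlds'') with domain $D$. For an injection $\iota:A\to B$ and $\omega\in\Omega^L_B$, the structure $\omega_\iota\in\Omega^L_A$ is given by $\omega_\iota\models R(\vec a)\iff\omega\models R(\iota(\vec a))$; when $A\subseteq B$ and $\iota$ is the inclusion we write $\omega_A$. A \emph{projective $L$-family of distributions} $P$ assigns to every finite set $D$ a probability distribution $P_D$ on $\Omega^L_D$ such that for every injection $\iota:A\to B$ the image of $P_B$ under $\omega\mapsto\omega_\iota$ is $P_A$. \textbf{Generalised PLPs.} A projective $L'$-family $P'$ is \emph{free} if there is $w:L'\to(0,1)$ with $P'_D(\omega)=\prod_{\omega\models R(\vec a)}w(R)\prod_{\omega\not\models R(\vec a)}(1-w(R))$ for all finite $D$ and $\omega\in\Omega^{L'}_D$ (products over all $R\in L'$ and all tuples $\vec a$ from $D$ of the length given by the arity of $R$). A \emph{generalised PLP} with signature $L_1$ consists of a subsignature $L'\subseteq L_1$, a free $L'$-family $P'$, and maps $\Pi_D:\Omega^{L'}_D\to\Omega^{L_1}_D$,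 one for every finite set $D$, such that $\Pi_D(\omega)$ expands $\omega$ for every $\omega$. It induces on each $\Omega^{L_1}_D$ the image of $P'_D$ under $\Pi_D$; it is \emph{projective} if these distributions form a projective $L_1$-family. For $L\subseteq L_1$, the \emph{reduct} to $L$ of a family of distributions on $\Omega^{L_1}_D$ is the family of its images under the maps sending each $L_1$-structure to its $L$-reduct. \textbf{Traces.} The \emph{$g$-ary trace} of $\omega\in\Omega^L_D$ is the set of all $\omega'\in\Omega^L_D$ with $\omega'_E=\omega_E$ for all $E\subseteq D$ with $|E|\le g$. A $g$-ary trace over $C\subseteq D$ is a $g$-ary trace of some world with domain $C$, and is identified with the event in $\Omega^L_D$ that $\omega_C$ belongs to it. \textbf{SIP.} Let $r$ be the maximal arity of a symbol in $L$. A quantifier-free equality-free formula whose variables are grounded to elements of $D$ \emph{mentions} a set $s\subseteq D$ if some atomic subformula $R(b_1,\dots,b_m)$ of it has $s\subseteq\{b_1,\dots,b_m\}$. The family $P$ satisfies the \emph{strong independence principle} if, for all $0\le g<r$, all finite $D$, all such formulas $\varphi,\psi$ over $D$ for which no $(g+1)$-element subset of $D$ is mentioned by both, and every $g$-ary trace $\theta$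 over the set of elements occurring in both $\varphi$ and $\psi$ with $P_D(\theta)>0$, \[P_D(\varphi\wedge\psi\mid\theta)=P_D(\varphi\mid\theta)\,P_D(\psi\mid\theta).\] \textbf{Essential asymmetry.} Let $|D|=g+1$ and $\omega\in\Omega^L_D$. The $(g+1)$-ary trace of $\omega$ is a \emph{symmetric extension} of its $g$-ary trace if every permutation of $D$ that leaves the $g$-ary trace of $\omega$ invariant leaves its $(g+1)$-ary trace invariant. The family $P$ is \emph{essentially asymmetric} if for some $g\ge0$, some $D$ with $|D|=g+1$ and some $g$-ary trace $\theta$ over $D$ with $P_D(\theta)>0$, the conditional probability given $\theta$ that the $(g+1)$-ary trace of $\omega$ is a symmetric extension of $\theta$ is $0$. \textbf{Theorem.} Let $L$ be a signature and let $P$ be a projective $L$-family of distributions that satisfies the strong independence principle and is not essentially asymmetric. Then there are a signature $L_1\supseteq L$ and a projective generalised PLP with signature $L_1$ such that $P$ is the reduct to $L$ of the family of distributions it induces. -/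

import Mathlib

open scoped ENNReal

universe u v

namespace PLP

/-- A finite relational signature; every relation symbol has positive arity (no propositions). -/
structure Signature where
  Rel : Type u
  [fintypeRel : Fintype Rel]
  arity : Rel → ℕ
  arity_pos : ∀ R, 0 < arity R

attribute [instance] Signature.fintypeRel

/-- The maximal arity of a relation symbol (`0` for the empty signature). -/
def Signature.maxArity (L : Signature.{u}) : ℕ := Finset.univ.sup L.arity

/-- `Inclusion L' L` exhibits `L'` as a subsignature of `L`. -/
structure Inclusion (L' L : Signature.{u}) where
  toFun : L'.Rel → L.Rel
  injective : Function.Injective toFun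
  arity_eq : ∀ R, L.arity (toFun R) = L'.arity R

/-- An `L`-structure with domain `D`. -/
abbrev World (L : Signature.{u}) (D : Type v) : Type (max u v) :=
  (R : L.Rel) → (Fin (L.arity R) → D) → Prop

/-- The structure `ω_ι` that an injection `ι : A → B` induces on `A` from `ω` on `B`. -/
def World.restrict {L : Signature.{u}} {A B : Type v} (ι : A ↪ B) (ω : World L B) : World L A :=
  fun R a => ω R (fun k => ι (a k))

/-- The reduct of an `L`-structure to a subsignature. -/
def World.reduct {L' L : Signature.{u}} (i : Inclusion L' L) {D : Type v} (ω : World L D) :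
    World L' D :=
  fun R a => ω (i.toFun R) (fun k => a (Fin.cast (i.arity_eq R) k))

/-- The probability of an event. -/
noncomputable def prob {α : Type*} (μ : PMF α) (s : Set α) : ℝ≥0∞ := μ.toOuterMeasure s

/-- The conditional probability of `s` given `t`, meant for `t` of positive probability. -/
noncomputable def condProb {α : Type*} (μ : PMF α) (s t : Set α) : ℝ≥0∞ :=
  prob μ (s ∩ t) / prob μ t

/-- A projective `L`-family of distributions: a random `L`-world for every finite domain, such that
the restriction along every injection is measure-preserving. -/
structure ProjectiveFamily (L : Signature.{u}) where
  law : (D : Type v) → [Finite D] → PMF (World L D)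
  projective : ∀ {A B : Type v} [Finite A] [Finite B] (ι : A ↪ B),
    (law B).map (World.restrict ι) = law A

open scoped Classical in
/-- The weight of `ω` when every ground atom `R(a)` is true independently with probability `w R`. -/
noncomputable def freeWeight {L : Signature.{u}} (w : L.Rel → Set.Ioo (0 : ℝ) 1)
    {D : Type v} [Fintype D] (ω : World L D) : ℝ≥0∞ :=
  ∏ R : L.Rel, ∏ a : Fin (L.arity R) → D,
    if ω R a then ENNReal.ofReal (w R) else ENNReal.ofReal (1 - w R)

/-- `P` is the free family defined by some weight function with values in `(0,1)`. -/
def ProjectiveFamily.IsFree {L : Signature.{u}} (P : ProjectiveFamily.{u, v} L) : Prop :=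
  ∃ w : L.Rel → Set.Ioo (0 : ℝ) 1,
    ∀ (D : Type v) [Fintype D] (ω : World L D), P.law D ω = freeWeight w ω

/-- A generalised probabilistic logic program with signature `L`: a free family over a subsignature
and a choice of expansions to `L`. -/
structure GeneralisedPLP (L : Signature.{u}) where
  freeSig : Signature.{u}
  incl : Inclusion freeSig L
  freeFamily : ProjectiveFamily.{u, v} freeSig
  isFree : freeFamily.IsFree
  expand : (D : Type v) → [Finite D] → World freeSig D → World L D
  expands : ∀ (D : Type v) [Finite D] (ω : World freeSig D), (expand D ω).reduct incl = ω

/-- The distribution over `L`-worlds with domain `D` induced by a generalised PLP. -/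
noncomputable def GeneralisedPLP.law {L : Signature.{u}} (Q : GeneralisedPLP.{u, v} L)
    (D : Type v) [Finite D] : PMF (World L D) :=
  (Q.freeFamily.law D).map (Q.expand D)

/-- A generalised PLP is projective if the distributions it induces form a projective family. -/
def GeneralisedPLP.IsProjective {L : Signature.{u}} (Q : GeneralisedPLP.{u, v} L) : Prop :=
  ∀ {A B : Type v} [Finite A] [Finite B] (ι : A ↪ B),
    (Q.law B).map (World.restrict ι) = Q.law A

/-- `P` is the reduct, along `i`, of the family of distributions induced by `Q`. -/
def ProjectiveFamily.IsReductOf {L L₁ : Signature.{u}} (P : ProjectiveFamily.{u, v} L)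
    (i : Inclusion L L₁) (Q : GeneralisedPLP.{u, v} L₁) : Prop :=
  ∀ (D : Type v) [Finite D], P.law D = (Q.law D).map (World.reduct i)

/-- Quantifier-free formulas (without equality) grounded to elements of `D`. -/
inductive GroundFormula (L : Signature.{u}) (D : Type v) : Type (max u v)
  | falsum : GroundFormula L D
  | atom (R : L.Rel) (a : Fin (L.arity R) → D) : GroundFormula L D
  | neg (φ : GroundFormula L D) : GroundFormula L D
  | conj (φ ψ : GroundFormula L D) : GroundFormula L D
  | disj (φ ψ : GroundFormula L D) : GroundFormula L D

namespace GroundFormula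

variable {L : Signature.{u}} {D : Type v}

/-- Truth in a world. -/
def Holds (ω : World L D) : GroundFormula L D → Prop
  | falsum => False
  | atom R a => ω R a
  | neg φ => ¬ φ.Holds ω
  | conj φ ψ => φ.Holds ω ∧ ψ.Holds ω
  | disj φ ψ => φ.Holds ω ∨ ψ.Holds ω

/-- The set of models of `φ` with domain `D`. -/
def models (φ : GroundFormula L D) : Set (World L D) := {ω | φ.Holds ω}

/-- The atomic subformulas. -/
def atoms : GroundFormula L D → Set ((R : L.Rel) × (Fin (L.arity R) → D))
  | falsum => ∅
  | atom R a => {⟨R, a⟩}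
  | neg φ => φ.atoms
  | conj φ ψ => φ.atoms ∪ ψ.atoms
  | disj φ ψ => φ.atoms ∪ ψ.atoms

/-- `φ` mentions the set `s` if some atomic subformula contains all elements of `s`. -/
def Mentions (φ : GroundFormula L D) (s : Set D) : Prop :=
  ∃ x ∈ φ.atoms, s ⊆ Set.range x.2

/-- The elements of `D` that occur in `φ`. -/
def constants (φ : GroundFormula L D) : Set D :=
  {d | ∃ x ∈ φ.atoms, d ∈ Set.range x.2}

end GroundFormula

/-- The `g`-ary trace of a world `ω`: all worlds on the same domain that have the same restriction
as `ω` to every set of at most `g` elements. -/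
def trace {L : Signature.{u}} {D : Type v} (g : ℕ) (ω : World L D) : Set (World L D) :=
  {ω' | ∀ E : Finset D, E.card ≤ g →
    ω'.restrict (Function.Embedding.subtype (· ∈ E)) =
      ω.restrict (Function.Embedding.subtype (· ∈ E))}

/-- The event, for worlds with domain `D`, that the `g`-ary trace over `C ⊆ D` is that of `τ`. -/
def traceOn {L : Signature.{u}} {D : Type v} (g : ℕ) (C : Set D) (τ : World L C) :
    Set (World L D) :=
  {ω | ω.restrict (Function.Embedding.subtype (· ∈ C)) ∈ trace g τ}

/-- The Strong Independence Principle. -/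
def ProjectiveFamily.SIP {L : Signature.{u}} (P : ProjectiveFamily.{u, v} L) : Prop :=
  ∀ g < L.maxArity, ∀ (D : Type v) [Finite D] (φ ψ : GroundFormula L D),
    (∀ s : Finset D, s.card = g + 1 → ¬ (φ.Mentions s ∧ ψ.Mentions s)) →
    ∀ τ : World L ↥(φ.constants ∩ ψ.constants),
      0 < prob (P.law D) (traceOn g _ τ) →
        condProb (P.law D) (φ.models ∩ ψ.models) (traceOn g _ τ) =
          condProb (P.law D) φ.models (traceOn g _ τ) *
            condProb (P.law D) ψ.models (traceOn g _ τ)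

/-- The `(g+1)`-ary trace of `ω` is a symmetric extension of its `g`-ary trace: every permutation of
the domain that fixes the `g`-ary trace fixes the `(g+1)`-ary trace. -/
def IsSymmetricExtension {L : Signature.{u}} {D : Type v} (g : ℕ) (ω : World L D) : Prop :=
  ∀ ρ : Equiv.Perm D, trace g (ω.restrict ρ.toEmbedding) = trace g ω →
    trace (g + 1) (ω.restrict ρ.toEmbedding) = trace (g + 1) ω

/-- Some `g`-ary trace over `g + 1` elements has positive probability, and almost surely its
extension to a `(g+1)`-ary trace is not symmetric. -/
def ProjectiveFamily.EssentiallyAsymmetric {L : Signature.{u}}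
    (P : ProjectiveFamily.{u, v} L) : Prop :=
  ∃ (g : ℕ) (D : Type v) (_ : Finite D) (τ : World L D), Nat.card D = g + 1 ∧
    0 < prob (P.law D) (trace g τ) ∧
    condProb (P.law D) {ω | IsSymmetricExtension g ω} (trace g τ) = 0

end PLP

/-! By the strong independence principle, given the `g`-ary trace the structures on the various
(g+1)-element sets are independent. Hence the weight of a world is a product, over nonempty sets E
of size at most the maximal arity, of the conditional probability of its structure on E given the
traces on proper subsets (`ProjectiveFamily.SIP.weight_eq_prod`). It therefore suffices to sample
each local structure with coins attached to E, that is, with free atoms whose arguments enumerate E.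

Such sampling must not depend on the enumeration, so it has to be equivariant under permutations of
E. The obstacle is that all biases lie in (0,1): with positive probability the coins do not
distinguish the enumerations, and the output must then be as symmetric as the trace. Failure of
essential asymmetry supplies a symmetric extension of positive probability. `exists_sampler` uses it
as follows. Coins select an enumeration equivariantly, except with a small probability q. On
success, coins at the selected enumeration draw the local structure; on failure, the symmetric
extension is returned. Its excess mass is subtracted from the law used on success, which is possible
because q is below every positive weight.

Local samples determine exactly one world (`LocalSampler.exists_isSampled`,
`LocalSampler.IsSampled.unique`). The characterisation passes to subdomains, so the program is
projective, and `LocalSampler.map_world_freeLaw` matches the law of the sampled world with the chain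
rule. -/

namespace PLP

/-! ### Masses of events in finite spaces -/

open scoped Classical in
/-- The total mass of the points of `A`. -/
noncomputable def mass {α : Type*} [Finite α] (f : α → ℝ) (A : Set α) : ℝ :=
  letI := Fintype.ofFinite α
  ∑ x, if x ∈ A then f x else 0

section Mass

variable {α : Type*} {f : α → ℝ}

open scoped Classical in
theorem mass_eq_sum [Fintype α] (f : α → ℝ) (A : Set α) :
    mass f A = ∑ x, if x ∈ A then f x else 0 := by
  unfold mass
  rw [Subsingleton.elim (Fintype.ofFinite α) ‹Fintype α›]

variable [Finite α]

theorem mass_nonneg (hf : ∀ x, 0 ≤ f x) (A : Set α) : 0 ≤ mass f A := by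
  classical
  have := Fintype.ofFinite α
  rw [mass_eq_sum]
  exact Finset.sum_nonneg fun x _ => by split_ifs <;> simp [hf]

theorem mass_mono (hf : ∀ x, 0 ≤ f x) {A B : Set α} (h : A ⊆ B) : mass f A ≤ mass f B := by
  classical
  have := Fintype.ofFinite α
  simp_rw [mass_eq_sum]
  refine Finset.sum_le_sum fun x _ => ?_
  split_ifs with h1 h2
  · exact le_rfl
  · exact absurd (h h1) h2
  · exact hf x
  · exact le_rfl

theorem mass_singleton (x : α) : mass f {x} = f x := by
  have := Fintype.ofFinite α
  classical
  rw [mass_eq_sum, Finset.sum_eq_single x] <;> simp +contextual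

theorem mass_univ [Fintype α] : mass f Set.univ = ∑ x, f x := by
  simp [mass_eq_sum]

theorem mass_empty : mass f ∅ = 0 := by
  simp [mass]

theorem le_mass (hf : ∀ x, 0 ≤ f x) {A : Set α} {x : α} (h : x ∈ A) : f x ≤ mass f A := by
  rw [← mass_singleton (f := f)]
  exact mass_mono hf (by simpa using h)

theorem mass_eq_sum_fiber {β : Type*} [Fintype β] (c : α → β) (A : Set α) :
    mass f A = ∑ b, mass f (A ∩ c ⁻¹' {b}) := by
  classical
  have := Fintype.ofFinite α
  simp_rw [mass_eq_sum]
  rw [Finset.sum_comm]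
  refine Finset.sum_congr rfl fun x _ => ?_
  by_cases h : x ∈ A <;> simp [h]

theorem mass_pos_iff (hf : ∀ x, 0 ≤ f x) {A : Set α} : 0 < mass f A ↔ ∃ x ∈ A, 0 < f x := by
  classical
  have := Fintype.ofFinite α
  constructor
  · intro h
    obtain ⟨x, -, hx⟩ := Finset.exists_lt_of_sum_lt
      (s := Finset.univ) (f := fun _ : α => (0 : ℝ)) (by simpa [mass_eq_sum] using h)
    by_cases hA : x ∈ A
    · exact ⟨x, hA, by simpa [hA] using hx⟩
    · simp [hA] at hx
  · rintro ⟨x, hA, hx⟩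
    exact hx.trans_le (le_mass hf hA)

end Mass

/-! ### Independent biased coins -/

open scoped Classical in
/-- The probability of the outcome `x` of independent coins with biases `w`. -/
noncomputable def coinWeight {I : Type*} [Finite I] (w : I → Set.Ioo (0 : ℝ) 1) (x : I → Prop) :
    ℝ :=
  letI := Fintype.ofFinite I
  ∏ i, if x i then (w i : ℝ) else 1 - w i

/-- The probability of an event about independent coins with biases `w`. -/
noncomputable def coinProb {I : Type*} [Finite I] (w : I → Set.Ioo (0 : ℝ) 1)
    (A : Set (I → Prop)) : ℝ :=
  mass (coinWeight w) A

section Coins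

variable {I J : Type*}

open scoped Classical in
theorem coinWeight_eq_prod [Fintype I] (w : I → Set.Ioo (0 : ℝ) 1) (x : I → Prop) :
    coinWeight w x = ∏ i, if x i then (w i : ℝ) else 1 - w i := by
  unfold coinWeight
  rw [Subsingleton.elim (Fintype.ofFinite I) ‹Fintype I›]

variable [Finite I] [Finite J]

theorem coinWeight_pos (w : I → Set.Ioo (0 : ℝ) 1) (x : I → Prop) : 0 < coinWeight w x := by
  refine Finset.prod_pos fun i _ => ?_
  have := (w i).2
  split_ifs
  · exact this.1
  · linarith [this.2]

-- Distributing the product of sums over truth values gives one term per outcome of all coins.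
open scoped Classical in
theorem coinProb_forall [Fintype I] (w : I → Set.Ioo (0 : ℝ) 1) (S : I → Set Prop) :
    coinProb w {x | ∀ i, x i ∈ S i} =
      ∏ i, ((if True ∈ S i then (w i : ℝ) else 0) + if False ∈ S i then 1 - (w i : ℝ) else 0) := by
  have h : ∀ i, ((if True ∈ S i then (w i : ℝ) else 0) + if False ∈ S i then 1 - (w i : ℝ) else 0) =
      ∑ p : Prop, if p ∈ S i then (if p then (w i : ℝ) else 1 - w i) else 0 := by
    intro i
    simp [Fintype.univ_Prop]
  simp_rw [h]
  rw [Fintype.prod_sum]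
  unfold coinProb
  simp_rw [mass_eq_sum, coinWeight_eq_prod]
  refine Finset.sum_congr rfl fun x _ => ?_
  split_ifs with hx
  · rw [Set.mem_ofPred_eq] at hx
    exact Finset.prod_congr rfl fun i _ => by simp [hx i]
  · rw [Set.mem_ofPred_eq] at hx
    push Not at hx
    obtain ⟨i, hi⟩ := hx
    exact (Finset.prod_eq_zero (Finset.mem_univ i) (by simp [hi])).symm

theorem coinProb_univ (w : I → Set.Ioo (0 : ℝ) 1) : coinProb w Set.univ = 1 := by
  have := Fintype.ofFinite I
  have := coinProb_forall w (fun _ => Set.univ)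
  simpa [Set.ofPred_forall] using this

theorem coinProb_comp_eq (w : I → Set.Ioo (0 : ℝ) 1) (e : J → I) (he : Function.Injective e)
    (y : J → Prop) : coinProb w {x | x ∘ e = y} = coinWeight (w ∘ e) y := by
  classical
  have := Fintype.ofFinite I
  have := Fintype.ofFinite J
  -- Coins outside the range of `e` are unconstrained and contribute the factor w + (1 - w) = 1.
  have h1 : {x : I → Prop | x ∘ e = y} = {x | ∀ i, x i ∈ {p : Prop | ∀ j, e j = i → p = y j}} := by
    ext x
    simp only [Set.mem_ofPred_eq, funext_iff, Function.comp]
    exact ⟨fun h i j hj => hj ▸ h j, fun h j => h _ j rfl⟩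
  rw [h1, coinProb_forall, coinWeight_eq_prod]
  symm
  refine Fintype.prod_of_injective e he _ _ ?_ ?_
  · intro i hi
    have : ∀ j, e j ≠ i := fun j hj => hi ⟨j, hj⟩
    simp [this]
  · intro j
    by_cases hy : y j <;> simp [he.eq_iff, hy]

theorem coinProb_comp (w : I → Set.Ioo (0 : ℝ) 1) (e : J → I) (he : Function.Injective e)
    (A : Set (J → Prop)) : coinProb w {x | x ∘ e ∈ A} = coinProb (w ∘ e) A := by
  classical
  have := Fintype.ofFinite J
  unfold coinProb
  rw [mass_eq_sum_fiber (fun x => x ∘ e), mass_eq_sum _ A]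
  refine Finset.sum_congr rfl fun y _ => ?_
  split_ifs with hy
  · rw [← coinProb_comp_eq w e he]
    unfold coinProb
    congr 1
    ext x
    simp only [Set.mem_inter_iff, Set.mem_ofPred_eq, Set.mem_preimage, Set.mem_singleton_iff]
    exact ⟨fun h => h.2, fun h => ⟨h ▸ hy, h⟩⟩
  · convert mass_empty (α := I → Prop) using 2
    ext x
    simp only [Set.mem_inter_iff, Set.mem_ofPred_eq, Set.mem_preimage, Set.mem_singleton_iff,
      Set.mem_empty_iff_false, iff_false]
    rintro ⟨h1, rfl⟩
    exact hy h1

/-- Independence of disjoint blocks of coins: by currying, an outcome is a choice of one outcome per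
block, so the product of block masses expands to the mass of the joint event. -/
theorem coinProb_sigma {X : I → Type*} [∀ i, Finite (X i)] [Fintype I]
    (w : (Σ i, X i) → Set.Ioo (0 : ℝ) 1) (A : ∀ i, Set (X i → Prop)) :
    coinProb w {x | ∀ i, (fun j => x ⟨i, j⟩) ∈ A i} = ∏ i, coinProb (fun j => w ⟨i, j⟩) (A i) := by
  classical
  have := fun i => Fintype.ofFinite (X i)
  unfold coinProb
  simp_rw [mass_eq_sum, coinWeight_eq_prod]
  rw [Fintype.prod_sum]
  refine Fintype.sum_equiv (Equiv.piCurry fun _ _ => Prop) _ _ fun x => ?_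
  split_ifs with hx
  · rw [Set.mem_ofPred_eq] at hx
    rw [Fintype.prod_sigma]
    refine Finset.prod_congr rfl fun i _ => ?_
    rw [if_pos]
    · rfl
    · exact hx i
  · rw [Set.mem_ofPred_eq] at hx
    push Not at hx
    obtain ⟨i, hi⟩ := hx
    refine (Finset.prod_eq_zero (Finset.mem_univ i) (if_neg ?_)).symm
    exact hi

theorem coinProb_sum (w : I ⊕ J → Set.Ioo (0 : ℝ) 1) (A : Set (I → Prop)) (B : Set (J → Prop)) :
    coinProb w {x | x ∘ Sum.inl ∈ A ∧ x ∘ Sum.inr ∈ B} =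
      coinProb (w ∘ Sum.inl) A * coinProb (w ∘ Sum.inr) B := by
  classical
  have := Fintype.ofFinite I
  have := Fintype.ofFinite J
  unfold coinProb
  simp_rw [mass_eq_sum, coinWeight_eq_prod]
  rw [Finset.sum_mul_sum, ← Finset.sum_product', Finset.univ_product_univ]
  refine Fintype.sum_equiv (Equiv.sumArrowEquivProdArrow I J Prop) _ _ fun x => ?_
  have h1 : (Equiv.sumArrowEquivProdArrow I J Prop x).1 = x ∘ Sum.inl := rfl
  have h2 : (Equiv.sumArrowEquivProdArrow I J Prop x).2 = x ∘ Sum.inr := rfl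
  rw [h1, h2]
  by_cases hA : x ∘ Sum.inl ∈ A <;> by_cases hB : x ∘ Sum.inr ∈ B <;> simp [hA, hB]

/-- Events about disjoint sets of coins are independent. -/
theorem coinProb_inter {K : Type*} [Finite K] (w : K → Set.Ioo (0 : ℝ) 1) (e₁ : I → K) (e₂ : J → K)
    (h₁ : Function.Injective e₁) (h₂ : Function.Injective e₂) (h : ∀ i j, e₁ i ≠ e₂ j)
    (A : Set (I → Prop)) (B : Set (J → Prop)) :
    coinProb w {x | x ∘ e₁ ∈ A ∧ x ∘ e₂ ∈ B} = coinProb (w ∘ e₁) A * coinProb (w ∘ e₂) B := by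
  have := coinProb_comp w (Sum.elim e₁ e₂) (h₁.sumElim h₂ h)
    {x | x ∘ Sum.inl ∈ A ∧ x ∘ Sum.inr ∈ B}
  rw [coinProb_sum] at this
  exact this

/-- Every distribution with finite support is the law of a function of finitely many coins. -/
theorem exists_coinProb_eq {Y : Type*} {s : Finset Y} (hs : s.Nonempty) (f : Y → ℝ)
    (hf : ∀ y ∈ s, 0 < f y) :
    ∃ (n : ℕ) (w : Fin n → Set.Ioo (0 : ℝ) 1) (h : (Fin n → Prop) → Y), (∀ x, h x ∈ s) ∧
      ∀ y ∈ s, coinProb w {x | h x = y} * ∑ z ∈ s, f z = f y := by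
  classical
  induction hs using Finset.Nonempty.cons_induction with
  | singleton a =>
    refine ⟨0, Fin.elim0, fun _ => a, by simp, ?_⟩
    intro y hy
    rw [Finset.mem_singleton] at hy
    subst hy
    have := coinProb_univ (Fin.elim0 : Fin 0 → Set.Ioo (0 : ℝ) 1)
    simp only [Set.ofPred_true, this]
    simp
  | cons a s ha hs ih =>
    obtain ⟨n, w, h, hmem, hprob⟩ := ih fun y hy => hf y (Finset.mem_cons_of_mem hy)
    have hfa : 0 < f a := hf a (Finset.mem_cons_self a s)
    have hS : 0 < ∑ z ∈ s, f z := Finset.sum_pos (fun y hy => hf y (Finset.mem_cons_of_mem hy)) hs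
    have hT : 0 < f a + ∑ z ∈ s, f z := by linarith
    -- The new first coin decides for `a` with its share of the total; otherwise the old coins
    -- decide within `s`. Nonemptiness of `s` keeps the bias below 1.
    let p : Set.Ioo (0 : ℝ) 1 := ⟨f a / (f a + ∑ z ∈ s, f z), by positivity, by
      rw [div_lt_one hT]; linarith⟩
    have hp : (p : ℝ) * (f a + ∑ z ∈ s, f z) = f a := div_mul_cancel₀ _ hT.ne'
    have single : coinProb (fun _ : Fin 1 => p) {x | x 0 ∈ ({True} : Set Prop)} = p ∧
        coinProb (fun _ : Fin 1 => p) {x | x 0 ∈ ({False} : Set Prop)} = 1 - p := by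
      constructor
      · have := coinProb_forall (fun _ : Fin 1 => p) (fun _ => {True})
        simpa using this
      · have := coinProb_forall (fun _ : Fin 1 => p) (fun _ => {False})
        simpa using this
    have hinj₁ : Function.Injective (fun _ : Fin 1 => (0 : Fin (n + 1))) :=
      Function.injective_of_subsingleton _
    refine ⟨n + 1, Fin.cons p w, fun x => if x 0 then a else h (x ∘ Fin.succ), ?_, ?_⟩
    · intro x
      dsimp only
      split_ifs
      · exact Finset.mem_cons_self a s
      · exact Finset.mem_cons_of_mem (hmem _)
    · intro y hy
      rw [Finset.sum_cons]
      rcases Finset.mem_cons.1 hy with rfl | hy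
      · have hset : {x : Fin (n + 1) → Prop | (if x 0 then y else h (x ∘ Fin.succ)) = y} =
            {x | x ∘ (fun _ : Fin 1 => (0 : Fin (n + 1))) ∈ {x | x 0 ∈ ({True} : Set Prop)}} := by
          ext x
          by_cases hx : x 0
          · simp [hx]
          · simp only [Set.mem_ofPred_eq, hx, if_false, Function.comp]
            refine ⟨fun e => absurd (hmem (x ∘ Fin.succ)) (by rw [e]; exact ha), fun e => ?_⟩
            simp at e
        rw [hset, coinProb_comp _ _ hinj₁]
        exact (congrArg (· * _) single.1).trans hp
      · have hya : a ≠ y := fun e => ha (e ▸ hy)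
        have hset : {x : Fin (n + 1) → Prop | (if x 0 then a else h (x ∘ Fin.succ)) = y} =
            {x | x ∘ (fun _ : Fin 1 => (0 : Fin (n + 1))) ∈ {x | x 0 ∈ ({False} : Set Prop)} ∧
              x ∘ Fin.succ ∈ {x | h x = y}} := by
          ext x
          by_cases hx : x 0
          · simp [hx, hya]
          · simp [hx, Function.comp_def]
        rw [hset, coinProb_inter _ _ _ hinj₁ (Fin.succ_injective n)
          (fun i j => (Fin.succ_ne_zero j).symm)]
        have h1 := single.2
        have h2 : (Fin.cons p w : Fin (n + 1) → Set.Ioo (0 : ℝ) 1) ∘ Fin.succ = w := by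
          ext i; simp
        have h3 : (Fin.cons p w : Fin (n + 1) → Set.Ioo (0 : ℝ) 1) ∘ (fun _ : Fin 1 => 0) =
          fun _ => p := rfl
        rw [h2, h3, h1]
        linear_combination hprob y hy - coinProb w {x | h x = y} * hp

end Coins

/-! ### Equivariant choice and equivariant sampling -/

theorem mass_preimage_equiv {α β : Type*} [Finite α] [Finite β] (e : α ≃ β) (f : β → ℝ)
    (A : Set β) : mass (f ∘ e) (e ⁻¹' A) = mass f A := by
  classical
  have := Fintype.ofFinite α
  have := Fintype.ofFinite β
  simp_rw [mass_eq_sum]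
  exact Fintype.sum_equiv e _ _ fun x => by simp

/-- A function can be chosen equivariantly if every point has a value that is at least as
symmetric. -/
theorem exists_equivariant_choice {G X Y : Type*} [Group G] [MulAction G X] [MulAction G Y]
    (R : X → Y → Prop) (hR : ∀ (g : G) x y, R x y → R (g • x) (g • y))
    (h : ∀ x, ∃ y, R x y ∧ MulAction.stabilizer G x ≤ MulAction.stabilizer G y) :
    ∃ ζ : X → Y, (∀ (g : G) x, ζ (g • x) = g • ζ x) ∧ ∀ x, R x (ζ x) := by
  choose z hz hstab using h
  -- Values are fixed at orbit representatives and transported along the orbits.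
  let r : X → X := fun x => (Quotient.mk (MulAction.orbitRel G X) x).out
  have hr : ∀ x, ∃ g : G, g • r x = x := fun x => by
    have := Quotient.exact (Quotient.out_eq (Quotient.mk (MulAction.orbitRel G X) x))
    exact (MulAction.orbitRel G X).symm this
  have hrg : ∀ (g : G) x, r (g • x) = r x := fun g x => by
    have : Quotient.mk (MulAction.orbitRel G X) (g • x) = Quotient.mk (MulAction.orbitRel G X) x :=
      Quotient.sound ⟨g, rfl⟩
    simp only [r, this]
  choose t ht using hr
  refine ⟨fun x => t x • z (r x), fun g x => ?_, fun x => ?_⟩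
  · dsimp only
    rw [hrg]
    -- Two transporters from the representative differ by an element of its stabiliser, which also
    -- fixes the chosen value.
    have h1 : (t (g • x))⁻¹ * (g * t x) ∈ MulAction.stabilizer G (r x) := by
      rw [MulAction.mem_stabilizer_iff, mul_smul, mul_smul, ht, inv_smul_eq_iff]
      have := ht (g • x)
      rw [hrg] at this
      exact this.symm
    have h2 := hstab _ h1
    rw [MulAction.mem_stabilizer_iff, mul_smul, inv_smul_eq_iff, mul_smul] at h2
    exact h2.symm
  · have := hR (t x) _ _ (hz (r x))
    rwa [ht] at this

/-- Finitely many fair coins for every element of a finite group select an element equivariantly,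
except with arbitrarily small probability. -/
theorem exists_equivariant_selection (G : Type*) [Group G] [Finite G] {ε : ℝ} (hε : 0 < ε) :
    ∃ (M : ℕ) (w : Fin M → Set.Ioo (0 : ℝ) 1) (c : (Fin M × G → Prop) → Option G),
      (∀ (g : G) b, c (fun i => b (i.1, g⁻¹ * i.2)) = (c b).map (g * ·)) ∧
      coinProb (fun i : Fin M × G => w i.1) {b | c b = none} < ε := by
  classical
  let half : Set.Ioo (0 : ℝ) 1 := ⟨1 / 2, by norm_num, by norm_num⟩
  let t := coinProb (fun _ : G => half) {x | ¬ ∃! ρ, x ρ}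
  have ht0 : 0 ≤ t := mass_nonneg (fun x => (coinWeight_pos _ x).le) _
  have ht1 : t < 1 := by
    have h := coinProb_univ (fun _ : G => half)
    unfold coinProb at h
    rw [mass_eq_sum_fiber (fun x => ∃! ρ, x ρ), Fintype.univ_Prop, Finset.sum_pair (by simp)] at h
    -- The outcome marking only the identity has positive weight, so a row fails with probability t
    -- < 1.
    have h1 : 0 < mass (coinWeight fun _ : G => half)
        (Set.univ ∩ (fun x => ∃! ρ, x ρ) ⁻¹' {True}) := by
      rw [mass_pos_iff (fun x => (coinWeight_pos _ x).le)]
      exact ⟨fun ρ => ρ = 1, by simp, coinWeight_pos _ _⟩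
    have h2 : t = mass (coinWeight fun _ : G => half)
        (Set.univ ∩ (fun x => ∃! ρ, x ρ) ⁻¹' {False}) := by
      unfold t coinProb
      congr 1
      ext x
      simp
    linarith
  obtain ⟨M, hM⟩ := exists_pow_lt_of_lt_one hε ht1
  let Q : (Fin (M + 1) × G → Prop) → Fin (M + 1) → Prop := fun b i => ∃! ρ, b (i, ρ)
  -- A row succeeds if it marks exactly one group element. Translation by `g` leaves `Q b`
  -- unchanged, so `epsilon` picks the same row before and after, and its marked element is
  -- translated.
  let c : (Fin (M + 1) × G → Prop) → Option G := fun b =>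
    if ∃ i, Q b i then some (Classical.epsilon fun ρ => b (Classical.epsilon (Q b), ρ)) else none
  refine ⟨M + 1, fun _ => half, c, fun g b => ?_, ?_⟩
  · have hQ : Q (fun i => b (i.1, g⁻¹ * i.2)) = Q b := by
      ext i
      constructor
      · rintro ⟨ρ, h1, h2⟩
        exact ⟨g⁻¹ * ρ, h1, fun σ hσ => by rw [← h2 (g * σ) (by simpa using hσ)]; simp⟩
      · rintro ⟨ρ, h1, h2⟩
        exact ⟨g * ρ, by simpa using h1, fun σ hσ => by rw [← h2 _ hσ]; simp⟩
    simp only [c, hQ]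
    split_ifs with h
    · have h1 := Classical.epsilon_spec h
      have h2 := Classical.epsilon_spec h1.exists
      have h3 : ∃ ρ, b (Classical.epsilon (Q b), g⁻¹ * ρ) :=
        ⟨g * Classical.epsilon fun ρ => b (Classical.epsilon (Q b), ρ), by simpa using h2⟩
      have h4 := Classical.epsilon_spec h3
      have h5 := h1.unique h2 h4
      simp only [Option.map_some, Option.some.injEq]
      conv_rhs => rw [h5]
      simp
    · rfl
  · have hnone : {b | c b = none} = {b | b ∘ (fun i : (Σ _ : Fin (M + 1), G) => (i.1, i.2)) ∈
        {x | ∀ i, (fun ρ => x ⟨i, ρ⟩) ∈ {x : G → Prop | ¬ ∃! ρ, x ρ}}} := by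
      ext b
      simp [c, Q]
    rw [hnone, coinProb_comp _ _ (fun a b h => by cases a; cases b; simp at h; simp [h])]
    have := coinProb_sigma (X := fun _ : Fin (M + 1) => G) (fun _ => half)
      (fun _ => {x | ¬ ∃! ρ, x ρ})
    refine (this.trans ?_).trans_lt (?_ : t ^ (M + 1) < ε)
    · rw [Finset.prod_const, Finset.card_univ, Fintype.card_fin]
    · exact (pow_le_pow_of_le_one ht0 ht1.le (Nat.le_succ M)).trans_lt hM

open scoped Classical in
/-- Sampling from the fibres of an equivariant idempotent map with a prescribed defect at one
point of the fibre. -/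
theorem exists_fiber_coins {Y : Type*} [Finite Y] (π : Y → Y) (p : Y → ℝ)
    (hp0 : ∀ y, 0 ≤ p y) (hp1 : mass p Set.univ ≤ 1) {q : ℝ}
    (hq : ∀ y, 0 < p y → q < p y) (θ z : Y) (hz : π z = π θ)
    (hpz : 0 < mass p {x | π x = π θ} → 0 < p z) :
    ∃ (n : ℕ) (w : Fin n → Set.Ioo (0 : ℝ) 1) (h : (Fin n → Prop) → Y), (∀ x, π (h x) = π θ) ∧
      ∀ y, π y = π θ → coinProb w {x | h x = y} * ((1 - q) * mass p {x | π x = π θ}) =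
        p y - if y = z then q * mass p {x | π x = π θ} else 0 := by
  classical
  have := Fintype.ofFinite Y
  set m := mass p {x | π x = π θ} with hm
  have hm1 : m ≤ 1 := (mass_mono hp0 (Set.subset_univ _)).trans hp1
  have hm0 : 0 ≤ m := mass_nonneg hp0 _
  rcases hm0.eq_or_lt with hm00 | hm0
  · refine ⟨0, Fin.elim0, fun _ => θ, fun _ => rfl, fun y hy => ?_⟩
    have : p y = 0 := le_antisymm (by rw [hm00, hm]; exact le_mass hp0 hy) (hp0 y)
    simp [← hm00, this]
  -- What remains to be drawn once the failure mass `q * m` has gone to `z`. It stays positive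
  -- wherever `p` is, because m ≤ 1 and q lies below each positive value of `p`.
  · let f : Y → ℝ := fun y => p y - if y = z then q * m else 0
    have hf0 : ∀ y, p y = 0 → f y = 0 := by
      intro y hy
      have : y ≠ z := by
        rintro rfl
        linarith [hpz hm0]
      simp [f, hy, this]
    have hfpos : ∀ y, 0 < p y → 0 < f y := by
      intro y hy
      simp only [f]
      have := hq y hy
      split_ifs
      · nlinarith
      · simpa using hy
    let s : Finset Y := {y | π y = π θ ∧ 0 < p y}
    have hzs : z ∈ s := by simp [s, hz, hpz hm0]
    obtain ⟨n, w, h, h1, h2⟩ := exists_coinProb_eq (s := s) ⟨z, hzs⟩ f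
      (fun y hy => hfpos y (by simp only [s, Finset.mem_filter] at hy; exact hy.2.2))
    have hsum : ∑ y ∈ s, f y = (1 - q) * m := by
      have h3 : ∑ y ∈ s, p y = m := by
        rw [hm, mass_eq_sum, ← Finset.sum_filter]
        refine Finset.sum_subset (fun y hy => ?_) fun y hy hys => ?_
        · simp only [s, Finset.mem_filter] at hy
          simpa using hy.2.1
        · simp only [s, Finset.mem_filter, Finset.mem_univ, true_and, not_and, not_lt,
            Set.mem_ofPred_eq] at hy hys
          exact le_antisymm (hys hy) (hp0 y)
      simp only [f, Finset.sum_sub_distrib, h3, Finset.sum_ite_eq', hzs, if_true]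
      ring
    refine ⟨n, w, h, fun x => ?_, fun y hy => ?_⟩
    · have := h1 x
      simp only [s, Finset.mem_filter] at this
      exact this.2.1
    · rw [← hsum]
      by_cases hys : y ∈ s
      · exact h2 y hys
      · have hpy : p y = 0 := by
          simp only [s, Finset.mem_filter, Finset.mem_univ, true_and, not_and, not_lt] at hys
          exact le_antisymm (hys hy) (hp0 y)
        have : {x | h x = y} = ∅ := by
          ext x
          simp only [Set.mem_ofPred_eq, Set.mem_empty_iff_false, iff_false]
          rintro rfl
          exact hys (h1 x)
        rw [this]
        unfold coinProb
        rw [mass_empty, zero_mul]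
        exact (hf0 y hpy).symm

/-- An equivariantly selected `ρ` breaks the symmetry: move the fibre by `ρ⁻¹`, draw there with the
coins at `ρ`, and move the result back. If the selection fails, return an equivariantly chosen point
of the fibre; the draw on success compensates exactly for this. Since `F b y` depends only on `π y`,
the event `F b y = y` says that sampling from the fibre of `y` yields `y`. -/
theorem exists_sampler_aux {G : Type u} {Y : Type v} [Group G] [Finite G] [Finite Y] [MulAction G Y]
    (π : Y → Y) (hidem : ∀ y, π (π y) = π y) (hπ : ∀ (g : G) y, π (g • y) = g • π y)
    (p : Y → ℝ) (hp0 : ∀ y, 0 ≤ p y) (hp : ∀ (g : G) y, p (g • y) = p y)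
    (hp1 : mass p Set.univ ≤ 1)
    (hsym : ∀ y, ∃ z, π z = π y ∧ MulAction.stabilizer G (π y) ≤ MulAction.stabilizer G z ∧
      (0 < mass p {x | π x = π y} → 0 < p z)) :
    ∃ (S : Type v) (_ : Finite S) (w : S → Set.Ioo (0 : ℝ) 1) (F : (S × G → Prop) → Y → Y),
      (∀ (g : G) b y, F (fun i => b (i.1, g⁻¹ * i.2)) (g • y) = g • F b y) ∧
      (∀ b y, F b (π y) = F b y) ∧ (∀ b y, π (F b y) = π y) ∧
      ∀ y, coinProb (fun i : S × G => w i.1) {b | F b y = y} * mass p {x | π x = π y} = p y := by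
  classical
  have := Fintype.ofFinite Y
  have := Fintype.ofFinite G
  have hmass : ∀ (g : G) y, mass p {x | π x = π (g • y)} = mass p {x | π x = π y} := by
    intro g y
    have := mass_preimage_equiv (MulAction.toPerm g : Equiv.Perm Y) p {x | π x = π (g • y)}
    rw [← this]
    have h1 : p ∘ (MulAction.toPerm g : Equiv.Perm Y) = p := funext fun x => hp g x
    rw [h1]
    congr 1
    ext x
    simp [hπ]
  obtain ⟨ζ, hζ, hζR⟩ := exists_equivariant_choice (G := G)
    (fun y z => π z = π y ∧ (0 < mass p {x | π x = π y} → 0 < p z))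
    (fun g y z h => ⟨by rw [hπ, hπ, h.1], by rw [hmass, hp]; exact h.2⟩)
    (fun y => by
      obtain ⟨z, h1, h2, h3⟩ := hsym y
      refine ⟨z, ⟨h1, h3⟩, le_trans (fun g hg => ?_) h2⟩
      rw [MulAction.mem_stabilizer_iff] at hg ⊢
      rw [← hπ, hg])
  -- Half the least positive value of `p`; inserting 1 ensures that a minimum exists and that ε < 1.
  obtain ⟨ε, hε, hε1, hεp⟩ : ∃ ε : ℝ, 0 < ε ∧ ε < 1 ∧ ∀ y, 0 < p y → ε < p y := by
    let s : Finset ℝ := insert 1 ((Finset.univ.image p).filter (0 < ·))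
    have hs : s.Nonempty := ⟨1, Finset.mem_insert_self _ _⟩
    have hpos : 0 < s.min' hs := by
      rw [Finset.lt_min'_iff]
      intro x hx
      rcases Finset.mem_insert.1 hx with rfl | hx
      · exact one_pos
      · exact (Finset.mem_filter.1 hx).2
    refine ⟨s.min' hs / 2, by positivity, ?_, fun y hy => ?_⟩
    · have := s.min'_le 1 (Finset.mem_insert_self _ _)
      linarith
    · have := s.min'_le (p y) (Finset.mem_insert_of_mem (by simp [hy]))
      linarith
  obtain ⟨M, w₀, c, hc, hcε⟩ := exists_equivariant_selection G hε
  set q := coinProb (fun i : Fin M × G => w₀ i.1) {b | c b = none} with hq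
  have hq1 : q < 1 := hcε.trans hε1
  have hfib := fun θ => exists_fiber_coins π p hp0 hp1 (q := q)
    (fun y hy => hcε.trans (hεp y hy)) θ (ζ (π θ)) (by rw [(hζR _).1, hidem])
    (fun h => (hζR (π θ)).2 (by rwa [hidem]))
  choose n w h hπh hprob using hfib
  let S := Fin M ⊕ Σ θ : Y, Fin (n θ)
  let W : S → Set.Ioo (0 : ℝ) 1 := Sum.elim w₀ fun i => w i.1 i.2
  let e₁ : Fin M × G → S × G := fun i => (Sum.inl i.1, i.2)
  let e₂ : G → (θ : Y) → Fin (n θ) → S × G := fun ρ θ j => (Sum.inr ⟨θ, j⟩, ρ)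
  let H : (S × G → Prop) → G → Y → Y := fun b ρ θ => h θ (b ∘ e₂ ρ θ)
  let F : (S × G → Prop) → Y → Y := fun b y =>
    match c (b ∘ e₁) with
    | none => ζ (π y)
    | some ρ => ρ • H b ρ (ρ⁻¹ • π y)
  have hFn : ∀ b y, c (b ∘ e₁) = none → F b y = ζ (π y) := fun b y hb => by simp only [F, hb]
  have hFs : ∀ b y ρ, c (b ∘ e₁) = some ρ → F b y = ρ • H b ρ (ρ⁻¹ • π y) := fun b y ρ hb => by
    simp only [F, hb]
  have hζπ : ∀ y, π (ζ (π y)) = π y := fun y => by rw [(hζR _).1, hidem]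
  refine ⟨S, inferInstance, W, F, fun g b y => ?_, fun b y => ?_, fun b y => ?_, fun y => ?_⟩
  · have hcg : c ((fun i : S × G => b (i.1, g⁻¹ * i.2)) ∘ e₁) = (c (b ∘ e₁)).map (g * ·) :=
      hc g (b ∘ e₁)
    rcases hb : c (b ∘ e₁) with _ | ρ
    · rw [hFn b y hb, hFn _ _ (by rw [hcg, hb]; rfl), hπ, hζ]
    · rw [hFs b y ρ hb, hFs _ _ (g * ρ) (by rw [hcg, hb]; rfl)]
      have h1 : (g * ρ)⁻¹ • π (g • y) = ρ⁻¹ • π y := by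
        rw [hπ, mul_inv_rev, mul_smul, inv_smul_smul]
      rw [h1, mul_smul]
      congr 2
      simp only [H]
      congr 1
      ext j
      simp [e₂]
  · simp only [F, hidem]
  · rcases hb : c (b ∘ e₁) with _ | ρ
    · rw [hFn b y hb, hζπ]
    · rw [hFs b y ρ hb, hπ, hπh, hπ, smul_inv_smul, hidem]
  · set m := mass p {x | π x = π y} with hm
    have hm_nonneg : 0 ≤ m := mass_nonneg hp0 _
    rcases hm_nonneg.eq_or_lt with hm0 | hm0
    · rw [← hm0, mul_zero]
      exact le_antisymm (hp0 y) (by rw [hm0, hm]; exact le_mass hp0 rfl)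
    have he₁ : Function.Injective e₁ := by
      rintro ⟨a, b⟩ ⟨a', b'⟩ hab
      exact Prod.ext (Sum.inl_injective (congrArg Prod.fst hab)) (congrArg Prod.snd hab :)
    have he₂ : ∀ ρ θ, Function.Injective (e₂ ρ θ) := by
      intro ρ θ j j' hj
      exact eq_of_heq (Sigma.mk.inj (Sum.inr_injective (congrArg Prod.fst hj))).2
    have hW₁ : (fun i : S × G => W i.1) ∘ e₁ = fun i => w₀ i.1 := rfl
    have hW₂ : ∀ ρ θ, (fun i : S × G => W i.1) ∘ e₂ ρ θ = w θ := fun ρ θ => rfl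
    -- The share of `p y` produced by failed selections.
    set d := (if y = ζ (π y) then q * m else 0) with hd
    have hnone : coinProb (fun i : S × G => W i.1)
        ({b | F b y = y} ∩ (fun b => c (b ∘ e₁)) ⁻¹' {none}) * m = d := by
      rw [hd]
      split_ifs with hy
      · rw [hq, ← hW₁, ← coinProb_comp _ _ he₁]
        congr 2
        ext b
        simp only [Set.mem_inter_iff, Set.mem_ofPred_eq, Set.mem_preimage, Set.mem_singleton_iff]
        exact ⟨fun hb => hb.2, fun hb => ⟨(hFn b y hb).trans hy.symm, hb⟩⟩
      · have hempty : {b | F b y = y} ∩ (fun b => c (b ∘ e₁)) ⁻¹' {none} = ∅ := by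
          ext b
          simp only [Set.mem_inter_iff, Set.mem_ofPred_eq, Set.mem_preimage, Set.mem_singleton_iff,
            Set.mem_empty_iff_false, iff_false, not_and]
          intro hb hb'
          exact hy (hb.symm.trans (hFn b y hb'))
        rw [hempty]
        unfold coinProb
        rw [mass_empty, zero_mul]
    have hsome : ∀ ρ, coinProb (fun i : S × G => W i.1)
        ({b | F b y = y} ∩ (fun b => c (b ∘ e₁)) ⁻¹' {some ρ}) * ((1 - q) * m) =
        coinProb (fun i : Fin M × G => w₀ i.1) {b | c b = some ρ} * (p y - d) := by
      intro ρ
      have hset : ({b | F b y = y} ∩ (fun b => c (b ∘ e₁)) ⁻¹' {some ρ}) =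
          {b | b ∘ e₁ ∈ {b | c b = some ρ} ∧
            b ∘ e₂ ρ (ρ⁻¹ • π y) ∈ {x | h (ρ⁻¹ • π y) x = ρ⁻¹ • y}} := by
        ext b
        simp only [Set.mem_inter_iff, Set.mem_ofPred_eq, Set.mem_preimage, Set.mem_singleton_iff]
        rw [and_comm]
        refine and_congr_right fun hb => ?_
        rw [hFs b y ρ hb, eq_inv_smul_iff]
      -- Selection and drawing use disjoint coins, hence are independent.
      rw [hset, coinProb_inter _ _ _ he₁ (he₂ _ _) (by simp [e₁, e₂]), hW₁, hW₂, mul_assoc]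
      congr 1
      have hmθ : mass p {x | π x = π (ρ⁻¹ • π y)} = m := by
        rw [hmass, hidem]
      have := hprob (ρ⁻¹ • π y) (ρ⁻¹ • y) (by rw [hπ, hπ, hidem])
      rw [hmθ, hp] at this
      rw [this, hd, hπ, hidem, hζ]
      simp
    have htot := coinProb_univ (fun i : Fin M × G => w₀ i.1)
    have hall := mass_eq_sum_fiber (f := coinWeight fun i : S × G => W i.1)
      (fun b => c (b ∘ e₁)) {b | F b y = y}
    unfold coinProb at htot
    rw [mass_eq_sum_fiber c, Fintype.sum_option] at htot
    rw [Fintype.sum_option] at hall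
    have hsum : ∑ ρ, coinProb (fun i : Fin M × G => w₀ i.1) {b | c b = some ρ} = 1 - q := by
      have h1 : ∀ o, Set.univ ∩ c ⁻¹' {o} = {b | c b = o} := by
        intro o
        ext b
        simp
      simp only [h1] at htot
      rw [← htot]
      unfold q coinProb
      ring
    have hsum' := Finset.sum_congr rfl fun ρ (_ : ρ ∈ Finset.univ) => hsome ρ
    rw [← Finset.sum_mul, ← Finset.sum_mul, hsum] at hsum'
    have hq1' : 1 - q ≠ 0 := by linarith
    -- Each `ρ` contributes its selection probability times `p y - d`; these probabilities sum to 1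
    -- - q, which cancels.
    have hfin : (∑ ρ, coinProb (fun i : S × G => W i.1)
        ({b | F b y = y} ∩ (fun b => c (b ∘ e₁)) ⁻¹' {some ρ})) * m = p y - d := by
      apply mul_left_cancel₀ hq1'
      linear_combination hsum'
    have : coinProb (fun i : S × G => W i.1) {b | F b y = y} = coinProb (fun i : S × G => W i.1)
        ({b | F b y = y} ∩ (fun b => c (b ∘ e₁)) ⁻¹' {none}) +
        ∑ ρ, coinProb (fun i : S × G => W i.1)
        ({b | F b y = y} ∩ (fun b => c (b ∘ e₁)) ⁻¹' {some ρ}) := hall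
    rw [this]
    linear_combination hnone + hfin

/-- Exact equivariant sampling from the fibres of an equivariant idempotent map `π`, with finitely
many coins for every group element: possible if every fibre of positive mass contains a point of
positive mass that is as symmetric as the fibre. -/
theorem exists_sampler {G : Type u} {Y : Type v} [Group G] [Finite G] [Finite Y] [MulAction G Y]
    (π : Y → Y) (hidem : ∀ y, π (π y) = π y) (hπ : ∀ (g : G) y, π (g • y) = g • π y)
    (p : Y → ℝ) (hp0 : ∀ y, 0 ≤ p y) (hp : ∀ (g : G) y, p (g • y) = p y)
    (hp1 : mass p Set.univ ≤ 1)
    (hsym : ∀ y, ∃ z, π z = π y ∧ MulAction.stabilizer G (π y) ≤ MulAction.stabilizer G z ∧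
      (0 < mass p {x | π x = π y} → 0 < p z)) :
    ∃ (N : ℕ) (w : Fin N → Set.Ioo (0 : ℝ) 1) (F : (Fin N × G → Prop) → Y → Y),
      (∀ (g : G) b y, F (fun i => b (i.1, g⁻¹ * i.2)) (g • y) = g • F b y) ∧
      (∀ b y, F b (π y) = F b y) ∧ (∀ b y, π (F b y) = π y) ∧
      ∀ y, coinProb (fun i : Fin N × G => w i.1) {b | F b y = y} * mass p {x | π x = π y} =
        p y := by
  obtain ⟨S, _, w, F, h1, h2, h3, h4⟩ := exists_sampler_aux π hidem hπ p hp0 hp hp1 hsym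
  obtain ⟨N, ⟨e⟩⟩ := Finite.exists_equiv_fin S
  refine ⟨N, w ∘ e.symm, fun b y => F (fun i => b (e i.1, i.2)) y,
    fun g b y => h1 g (fun i => b (e i.1, i.2)) y,
    fun b y => h2 _ y, fun b y => h3 _ y, fun y => ?_⟩
  rw [← h4 y]
  congr 1
  refine (coinProb_comp (fun i : Fin N × G => (w ∘ e.symm) i.1) (fun i : S × G => (e i.1, i.2))
    ?_ {b | F b y = y}).trans ?_
  · rintro ⟨a, b⟩ ⟨a', b'⟩ hab
    simpa using hab
  · congr 1
    ext i
    simp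

/-! ### Probabilities as real masses -/

section RealProb

variable {α β : Type*} [Finite α] [Finite β]

theorem toReal_prob (μ : PMF α) (A : Set α) :
    (prob μ A).toReal = mass (fun x => (μ x).toReal) A := by
  classical
  have := Fintype.ofFinite α
  unfold prob
  rw [PMF.toOuterMeasure_apply_fintype, mass_eq_sum, ENNReal.toReal_sum]
  · refine Finset.sum_congr rfl fun x _ => ?_
    by_cases h : x ∈ A <;> simp [h]
  · intro x _
    by_cases h : x ∈ A <;> simp [h, μ.apply_ne_top]

theorem mass_toReal_univ (μ : PMF α) : mass (fun x => (μ x).toReal) Set.univ = 1 := by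
  rw [← toReal_prob, prob, (PMF.toOuterMeasure_apply_eq_one_iff _ _).2 (Set.subset_univ _),
    ENNReal.toReal_one]

theorem mass_toReal_map (μ : PMF α) (g : α → β) (A : Set β) :
    mass (fun x => ((μ.map g) x).toReal) A = mass (fun x => (μ x).toReal) (g ⁻¹' A) := by
  rw [← toReal_prob, ← toReal_prob, prob, PMF.toOuterMeasure_map_apply, prob]

end RealProb

/-! ### Events fixing a set of atoms, and traces -/

variable {L : Signature.{u}} {D : Type v}

/-- The worlds in which the atoms in `T` have the same truth value as in `ω`. -/
def agree (T : Set ((R : L.Rel) × (Fin (L.arity R) → D))) (ω : World L D) : Set (World L D) :=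
  {ω' | ∀ x ∈ T, (ω' x.1 x.2 ↔ ω x.1 x.2)}

theorem agree_union (T U : Set ((R : L.Rel) × (Fin (L.arity R) → D))) (ω : World L D) :
    agree (T ∪ U) ω = agree T ω ∩ agree U ω := by
  ext ω'
  simp only [agree, Set.mem_ofPred_eq, Set.mem_inter_iff, Set.mem_union]
  exact ⟨fun h => ⟨fun x hx => h x (Or.inl hx), fun x hx => h x (Or.inr hx)⟩,
    fun h x hx => hx.elim (h.1 x) (h.2 x)⟩

theorem agree_anti {T U : Set ((R : L.Rel) × (Fin (L.arity R) → D))} (h : T ⊆ U) (ω : World L D) :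
    agree U ω ⊆ agree T ω :=
  fun _ hω x hx => hω x (h hx)

theorem agree_univ (ω : World L D) : agree Set.univ ω = {ω} := by
  ext ω'
  simp only [agree, Set.mem_ofPred_eq, Set.mem_univ, true_imp_iff, Set.mem_singleton_iff]
  exact ⟨fun h => funext fun R => funext fun a => propext (h ⟨R, a⟩), fun h => by simp [h]⟩

theorem agree_empty (ω : World L D) : agree ∅ ω = Set.univ := by
  ext ω'
  simp [agree]

open Classical in
/-- The diagram of a world on a finite set of atoms. -/
theorem exists_diagram [Finite D] (T : Set ((R : L.Rel) × (Fin (L.arity R) → D)))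
    (ω : World L D) :
    ∃ φ : GroundFormula L D, φ.atoms = T ∧ φ.models = agree T ω := by
  induction T, T.toFinite using Set.Finite.induction_on with
  | empty =>
    refine ⟨.neg .falsum, rfl, ?_⟩
    ext ω'
    simp [GroundFormula.models, GroundFormula.Holds, agree]
  | @insert x T hx _ ih =>
    obtain ⟨φ, h1, h2⟩ := ih
    have h3 : ∀ ω', φ.Holds ω' ↔ ω' ∈ agree T ω := fun ω' => by rw [← h2]; rfl
    refine ⟨.conj (if ω x.1 x.2 then .atom x.1 x.2 else .neg (.atom x.1 x.2)) φ, ?_, ?_⟩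
    · split_ifs <;> simp [GroundFormula.atoms, h1]
    · ext ω'
      rw [Set.insert_eq, agree_union]
      simp only [GroundFormula.models, Set.mem_ofPred_eq, GroundFormula.Holds, h3,
        Set.mem_inter_iff]
      refine and_congr ?_ Iff.rfl
      split_ifs with h <;> simp [GroundFormula.Holds, agree, h]

/-- An atom with at most `g` distinct arguments is visible on its own range, which is one of the
sets E in the definition of the trace. -/
theorem mem_trace_iff {g : ℕ} {ω ω' : World L D} :
    ω' ∈ trace g ω ↔ ω' ∈ agree {x | (Set.range x.2).ncard ≤ g} ω := by
  classical
  constructor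
  · rintro h ⟨R, a⟩ hx
    have hE := h (Set.finite_range a).toFinset (by
      rw [← Set.ncard_eq_toFinset_card _ (Set.finite_range a)]; exact hx)
    exact iff_of_eq (congrFun (congrFun hE R) fun k => ⟨a k, by simp⟩)
  · intro h E hE
    funext R a
    refine propext (h ⟨R, fun k => a k⟩ ?_)
    have : Set.range (fun k => (a k : D)) ⊆ (E : Set D) := by
      rintro _ ⟨k, rfl⟩
      exact (a k).2
    have := Set.ncard_le_ncard this E.finite_toSet
    rw [Set.ncard_coe_finset] at this
    exact this.trans hE

theorem trace_eq_agree (g : ℕ) (ω : World L D) :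
    trace g ω = agree {x | (Set.range x.2).ncard ≤ g} ω :=
  Set.ext fun _ => mem_trace_iff

theorem restrict_mem_agree_iff {A : Type v} (ι : A ↪ D) {ω ω' : World L D}
    {T : Set ((R : L.Rel) × (Fin (L.arity R) → A))} :
    ω'.restrict ι ∈ agree T (ω.restrict ι) ↔
      ω' ∈ agree ((fun x => ⟨x.1, fun k => ι (x.2 k)⟩) '' T) ω := by
  simp only [agree, Set.mem_ofPred_eq, World.restrict, Set.forall_mem_image]

theorem image_comp_ncard_le {A : Type v} (ι : A ↪ D) (g : ℕ) :
    (fun x : (R : L.Rel) × (Fin (L.arity R) → A) =>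
        (⟨x.1, fun k => ι (x.2 k)⟩ : (R : L.Rel) × (Fin (L.arity R) → D))) ''
      {x | (Set.range x.2).ncard ≤ g} =
    {x | Set.range x.2 ⊆ Set.range ι ∧ (Set.range x.2).ncard ≤ g} := by
  have hr : ∀ (n : ℕ) (a : Fin n → A), (Set.range fun k => ι (a k)).ncard = (Set.range a).ncard :=
    fun n a => by
      rw [← Set.ncard_image_of_injective (Set.range a) ι.injective, ← Set.range_comp]
      rfl
  ext ⟨R, a⟩
  constructor
  · rintro ⟨⟨R, b⟩, hb, heq⟩
    cases heq
    refine ⟨?_, (hr _ b).trans_le hb⟩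
    rintro _ ⟨k, rfl⟩
    exact ⟨b k, rfl⟩
  · rintro ⟨h1, h2⟩
    choose b hb using fun k => h1 ⟨k, rfl⟩
    have hba : (fun k => ι (b k)) = a := funext hb
    refine ⟨⟨R, b⟩, ?_, Sigma.ext rfl (heq_of_eq hba)⟩
    rw [Set.mem_ofPred_eq, ← hr, hba]
    exact h2

theorem restrict_mem_agree_ncard_le_iff {A : Type v} (ι : A ↪ D) {g : ℕ} {ω ω' : World L D} :
    ω'.restrict ι ∈ agree {x | (Set.range x.2).ncard ≤ g} (ω.restrict ι) ↔
      ω' ∈ agree {x | Set.range x.2 ⊆ Set.range ι ∧ (Set.range x.2).ncard ≤ g} ω := by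
  rw [restrict_mem_agree_iff, image_comp_ncard_le]

theorem traceOn_eq_agree (g : ℕ) (C : Set D) (ω : World L D) :
    traceOn g C (ω.restrict (Function.Embedding.subtype (· ∈ C))) =
      agree {x | Set.range x.2 ⊆ C ∧ (Set.range x.2).ncard ≤ g} ω := by
  have hC : Set.range (Function.Embedding.subtype (· ∈ C)) = C := Subtype.range_coe
  ext ω'
  rw [traceOn, Set.mem_ofPred_eq, mem_trace_iff, restrict_mem_agree_ncard_le_iff, hC]

/-! ### Strong independence and the chain rule -/

/-- The probability that a projective family assigns to a world, as a real number. -/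
noncomputable def ProjectiveFamily.weight (P : ProjectiveFamily.{u, v} L) (D : Type v) [Finite D]
    (ω : World L D) : ℝ :=
  (P.law D ω).toReal

theorem ProjectiveFamily.weight_nonneg (P : ProjectiveFamily.{u, v} L) [Finite D]
    (ω : World L D) : 0 ≤ P.weight D ω :=
  ENNReal.toReal_nonneg

theorem ProjectiveFamily.mass_restrict (P : ProjectiveFamily.{u, v} L) {A : Type v} [Finite A]
    [Finite D] (ι : A ↪ D) (S : Set (World L A)) :
    mass (P.weight D) (World.restrict ι ⁻¹' S) = mass (P.weight A) S := by
  have := mass_toReal_map (P.law D) (World.restrict ι) S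
  rw [P.projective] at this
  exact this.symm

variable {P : ProjectiveFamily.{u, v} L}

/-- The strong independence principle, for events determined by atoms. -/
theorem ProjectiveFamily.SIP.mass_agree (hP : P.SIP) [Finite D] {g : ℕ} (hg : g < L.maxArity)
    (T U : Set ((R : L.Rel) × (Fin (L.arity R) → D))) (C : Set D)
    (hTU : ∀ s : Finset D, s.card = g + 1 →
      ¬ ((∃ x ∈ T, (s : Set D) ⊆ Set.range x.2) ∧ ∃ x ∈ U, (s : Set D) ⊆ Set.range x.2))
    (hC : (⋃ x ∈ T, Set.range x.2) ∩ (⋃ x ∈ U, Set.range x.2) = C)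
    (hT : {x | Set.range x.2 ⊆ C ∧ (Set.range x.2).ncard ≤ g} ⊆ T)
    (hU : {x | Set.range x.2 ⊆ C ∧ (Set.range x.2).ncard ≤ g} ⊆ U) (ω : World L D) :
    mass (P.weight D) (agree (T ∪ U) ω) *
        mass (P.weight D) (agree {x | Set.range x.2 ⊆ C ∧ (Set.range x.2).ncard ≤ g} ω) =
      mass (P.weight D) (agree T ω) * mass (P.weight D) (agree U ω) := by
  -- Diagrams have exactly the prescribed atoms, so mentioned sets and constants are read off from
  -- `T` and `U`.
  obtain ⟨φ, hφ, hφm⟩ := exists_diagram T ω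
  obtain ⟨ψ, hψ, hψm⟩ := exists_diagram U ω
  have hC' : φ.constants ∩ ψ.constants = C := by
    rw [← hC]
    ext d
    simp [GroundFormula.constants, hφ, hψ]
  have key := hP g hg D φ ψ (fun s hs => by
    rw [GroundFormula.Mentions, GroundFormula.Mentions, hφ, hψ]
    exact hTU s hs)
  rw [hC'] at key
  specialize key (ω.restrict (Function.Embedding.subtype (· ∈ C)))
  rw [traceOn_eq_agree, hφm, hψm] at key
  set Θ := agree {x | Set.range x.2 ⊆ C ∧ (Set.range x.2).ncard ≤ g} ω
  have hTΘ : agree T ω ⊆ Θ := agree_anti hT ω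
  have hUΘ : agree U ω ⊆ Θ := agree_anti hU ω
  have hm : ∀ A, mass (P.weight D) A = (prob (P.law D) A).toReal := fun A => (toReal_prob _ A).symm
  rw [agree_union]
  -- The cross-multiplied form also covers null traces, where both sides vanish.
  rcases (mass_nonneg P.weight_nonneg Θ).eq_or_lt with h0 | h0
  · have hT0 : mass (P.weight D) (agree T ω) = 0 :=
      le_antisymm (h0 ▸ mass_mono P.weight_nonneg hTΘ) (mass_nonneg P.weight_nonneg _)
    rw [← h0, hT0]
    ring
  · have h := key (ENNReal.toReal_pos_iff.1 (hm Θ ▸ h0)).1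
    have h := congrArg ENNReal.toReal h
    simp only [condProb, ENNReal.toReal_mul, ENNReal.toReal_div, ← hm] at h
    rw [Set.inter_eq_self_of_subset_left hTΘ, Set.inter_eq_self_of_subset_left hUΘ,
      Set.inter_eq_self_of_subset_left (Set.inter_subset_left.trans hTΘ)] at h
    field_simp at h
    linear_combination h

/-- The local structures on sets of `g + 1` elements are independent given the `g`-ary trace. -/
theorem ProjectiveFamily.SIP.mass_agree_local (hP : P.SIP) [Finite D] {g : ℕ}
    (hg : g < L.maxArity) (ω : World L D) (q : Finset D → ℝ)
    (hq : ∀ E : Finset D, E.card = g + 1 →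
      mass (P.weight D) (agree {x | Set.range x.2 ⊆ E} ω) =
        q E * mass (P.weight D) (agree {x | Set.range x.2 ⊆ E ∧ (Set.range x.2).ncard ≤ g} ω))
    (𝓕 : Finset (Finset D)) (h𝓕 : ∀ E ∈ 𝓕, E.card = g + 1) :
    mass (P.weight D)
        (agree ({x | (Set.range x.2).ncard ≤ g} ∪ {x | ∃ E ∈ 𝓕, Set.range x.2 = E}) ω) =
      mass (P.weight D) (agree {x | (Set.range x.2).ncard ≤ g} ω) * ∏ E ∈ 𝓕, q E := by
  classical
  induction 𝓕 using Finset.induction_on with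
  | empty => simp
  | insert E 𝓕 hE ih =>
    have ih := ih fun E' h' => h𝓕 E' (Finset.mem_insert_of_mem h')
    have hEc := h𝓕 E (Finset.mem_insert_self _ _)
    rw [Finset.prod_insert hE]
    set T : Set ((R : L.Rel) × (Fin (L.arity R) → D)) :=
      {x | (Set.range x.2).ncard ≤ g} ∪ {x | ∃ E ∈ 𝓕, Set.range x.2 = E} with hT
    set U : Set ((R : L.Rel) × (Fin (L.arity R) → D)) := {x | Set.range x.2 ⊆ E} with hU
    -- A (g+1)-set mentioned on the `T` side lies in `𝓕`, and on the `U` side it is the new `E`; so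
    -- none is mentioned by both.
    have hTs : ∀ x ∈ T, ∀ s : Finset D, s.card = g + 1 → (s : Set D) ⊆ Set.range x.2 → s ∈ 𝓕 := by
      intro x hx s hs hsx
      have h1 := Set.ncard_le_ncard hsx (Set.toFinite _)
      rw [Set.ncard_coe_finset, hs] at h1
      rcases hx with hx | ⟨E', hE', hx⟩
      · exact absurd h1 (by simpa using hx)
      · rw [hx] at hsx
        have := Finset.eq_of_subset_of_card_le (Finset.coe_subset.1 hsx)
          (by rw [hs, h𝓕 E' (Finset.mem_insert_of_mem hE')])
        rwa [this]
    have hUs : ∀ x ∈ U, ∀ s : Finset D, s.card = g + 1 → (s : Set D) ⊆ Set.range x.2 → s = E := by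
      intro x hx s hs hsx
      exact Finset.eq_of_subset_of_card_le (Finset.coe_subset.1 (hsx.trans hx)) (by rw [hs, hEc])
    have hunion : {x : (R : L.Rel) × (Fin (L.arity R) → D) | (Set.range x.2).ncard ≤ g} ∪
        {x | ∃ E' ∈ insert E 𝓕, Set.range x.2 = E'} = T ∪ U := by
      ext x
      simp only [hT, hU, Set.mem_union, Set.mem_ofPred_eq, Finset.mem_insert]
      constructor
      · rintro (h | ⟨E', rfl | h', h⟩)
        · exact Or.inl (Or.inl h)
        · exact Or.inr h.subset
        · exact Or.inl (Or.inr ⟨E', h', h⟩)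
      · rintro ((h | ⟨E', h', h⟩) | h)
        · exact Or.inl h
        · exact Or.inr ⟨E', Or.inr h', h⟩
        · by_cases hx : (Set.range x.2).ncard ≤ g
          · exact Or.inl hx
          · refine Or.inr ⟨E, Or.inl rfl, Set.eq_of_subset_of_ncard_le h ?_⟩
            rw [Set.ncard_coe_finset, hEc]
            omega
    -- The common constants may form a proper subset of `E`, but no small atom is lost: an atom with
    -- at most `g` elements forces g ≥ 1 as arities are positive, and then R(d,…,d) puts each of its
    -- elements on both sides.
    have hsmall : {x : (R : L.Rel) × (Fin (L.arity R) → D) |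
        Set.range x.2 ⊆ ((⋃ x ∈ T, Set.range x.2) ∩ (⋃ x ∈ U, Set.range x.2)) ∧
          (Set.range x.2).ncard ≤ g} = {x | Set.range x.2 ⊆ E ∧ (Set.range x.2).ncard ≤ g} := by
      have hsub : (⋃ x ∈ T, Set.range x.2) ∩ (⋃ x ∈ U, Set.range x.2) ⊆ (E : Set D) :=
        Set.inter_subset_right.trans (Set.iUnion₂_subset fun x hx => hx)
      ext x
      simp only [Set.mem_ofPred_eq]
      refine and_congr_left fun hx => ⟨fun h => h.trans hsub, fun h => h.trans ?_⟩
      intro d hd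
      have hg0 : 1 ≤ g := by
        refine le_trans ?_ hx
        rw [Nat.one_le_iff_ne_zero, Ne, Set.ncard_eq_zero (Set.toFinite _),
          Set.range_eq_empty_iff]
        have := L.arity_pos x.1
        exact fun h => h.elim ⟨0, this⟩
      have hpos := L.arity_pos x.1
      have hr : Set.range (fun _ : Fin (L.arity x.1) => d) = {d} := by
        have : Nonempty (Fin (L.arity x.1)) := ⟨⟨0, hpos⟩⟩
        exact Set.range_const
      refine ⟨Set.mem_iUnion₂.2 ⟨⟨x.1, fun _ => d⟩, Or.inl ?_, ⟨0, hpos⟩, rfl⟩,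
        Set.mem_iUnion₂.2 ⟨⟨x.1, fun _ => d⟩, ?_, ⟨0, hpos⟩, rfl⟩⟩
      · simp only [Set.mem_ofPred_eq, hr, Set.ncard_singleton, hg0]
      · simp only [hU, Set.mem_ofPred_eq, hr]
        simpa using hd
    have key := hP.mass_agree hg T U _ (fun s hs => by
      rintro ⟨⟨x, hx, hsx⟩, y, hy, hsy⟩
      have := hUs y hy s hs hsy
      subst this
      exact hE (hTs x hx s hs hsx)) rfl
      (by rw [hsmall]; exact fun x hx => Or.inl hx.2)
      (by rw [hsmall]; exact fun x hx => hx.1) ω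
    rw [hsmall, ih, hq E hEc] at key
    rw [hunion]
    rcases (mass_nonneg P.weight_nonneg (agree {x : (R : L.Rel) × (Fin (L.arity R) → D) |
      Set.range x.2 ⊆ E ∧ (Set.range x.2).ncard ≤ g} ω)).eq_or_lt with h0 | h0
    · have hsub : ∀ V : Set ((R : L.Rel) × (Fin (L.arity R) → D)),
          {x | Set.range x.2 ⊆ E ∧ (Set.range x.2).ncard ≤ g} ⊆ V →
          mass (P.weight D) (agree V ω) = 0 := fun V hV =>
        le_antisymm (h0 ▸ mass_mono P.weight_nonneg (agree_anti hV ω))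
          (mass_nonneg P.weight_nonneg _)
      rw [hsub (T ∪ U) fun x hx => Or.inr hx.1,
        hsub {x | (Set.range x.2).ncard ≤ g} fun x hx => hx.2]
      ring
    · apply mul_right_cancel₀ h0.ne'
      linear_combination key

/-- The chain rule: the weight of a world is the product of the conditional probabilities of its
local structures. -/
theorem ProjectiveFamily.SIP.weight_eq_prod (hP : P.SIP) [Fintype D] (ω : World L D)
    (q : Finset D → ℝ)
    (hq : ∀ E : Finset D, 0 < E.card → E.card ≤ L.maxArity →
      mass (P.weight D) (agree {x | Set.range x.2 ⊆ E} ω) = q E *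
        mass (P.weight D) (agree {x | Set.range x.2 ⊆ E ∧ (Set.range x.2).ncard < E.card} ω)) :
    P.weight D ω = ∏ E : Finset D with 0 < E.card ∧ E.card ≤ L.maxArity, q E := by
  classical
  -- The partial product up to level `g` is the mass of the `g`-ary trace; at the maximal arity that
  -- trace is the single world.
  have main : ∀ g ≤ L.maxArity, mass (P.weight D) (agree {x | (Set.range x.2).ncard ≤ g} ω) =
      ∏ E : Finset D with 0 < E.card ∧ E.card ≤ g, q E := by
    intro g
    induction g with
    | zero =>
      intro _
      have h1 : {x : (R : L.Rel) × (Fin (L.arity R) → D) | (Set.range x.2).ncard ≤ 0} = ∅ := by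
        ext x
        simp only [Set.mem_ofPred_eq, nonpos_iff_eq_zero, Set.mem_empty_iff_false, iff_false]
        rw [Set.ncard_eq_zero (Set.toFinite _), Set.range_eq_empty_iff]
        have := L.arity_pos x.1
        exact fun h => h.elim ⟨0, this⟩
      have h2 : (Finset.univ.filter fun E : Finset D => 0 < E.card ∧ E.card ≤ 0) = ∅ := by
        ext E
        simp only [Finset.mem_filter, Finset.notMem_empty, iff_false]
        omega
      rw [h1, h2, agree_empty, Finset.prod_empty]
      exact mass_toReal_univ _
    | succ g ih =>
      intro hg
      have h1 : {x : (R : L.Rel) × (Fin (L.arity R) → D) | (Set.range x.2).ncard ≤ g + 1} =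
          {x | (Set.range x.2).ncard ≤ g} ∪
            {x | ∃ E ∈ Finset.powersetCard (g + 1) (Finset.univ : Finset D),
              Set.range x.2 = E} := by
        ext x
        simp only [Set.mem_ofPred_eq, Set.mem_union, Finset.mem_powersetCard, Finset.subset_univ,
          true_and]
        constructor
        · intro h
          by_cases h' : (Set.range x.2).ncard ≤ g
          · exact Or.inl h'
          · refine Or.inr ⟨(Set.range x.2).toFinite.toFinset, ?_, by simp⟩
            rw [← Set.ncard_eq_toFinset_card _]
            omega
        · rintro (h | ⟨E, hE, h⟩)
          · omega
          · rw [h, Set.ncard_coe_finset, hE]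
      rw [h1, hP.mass_agree_local hg ω q _ _ fun E hE => (Finset.mem_powersetCard.1 hE).2,
        ih (by omega), ← Finset.prod_union]
      · congr 1
        ext E
        simp only [Finset.mem_union, Finset.mem_filter, Finset.mem_univ, true_and,
          Finset.mem_powersetCard, Finset.subset_univ]
        omega
      · rw [Finset.disjoint_left]
        intro E hE hE'
        have h2 := (Finset.mem_filter.1 hE).2
        have h3 := (Finset.mem_powersetCard.1 hE').2
        omega
      · intro E hE
        rw [hq E (by omega) (by omega), hE]
        simp only [Nat.lt_succ_iff]
  rw [← main _ le_rfl, ← mass_singleton (f := P.weight D), ← agree_univ]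
  congr 2
  refine (Set.eq_univ_of_forall fun x => ?_).symm
  have h1 : (Set.range x.2).ncard ≤ L.arity x.1 := by
    have := Set.ncard_image_le (f := x.2) (Set.finite_univ)
    rwa [Set.image_univ, Set.ncard_univ, Nat.card_eq_fintype_card, Fintype.card_fin] at this
  exact h1.trans (Finset.le_sup (f := L.arity) (Finset.mem_univ x.1))

/-! ### Permutations, truncation and sampling one local structure -/

variable {L : Signature.{u}} {D : Type v}

theorem World.restrict_trans {A B C : Type v} (ι : A ↪ B) (κ : B ↪ C) (ω : World L C) :
    (ω.restrict κ).restrict ι = ω.restrict (ι.trans κ) :=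
  rfl

/-- Permutations of the domain act on worlds. -/
abbrev World.permAction (L : Signature.{u}) (D : Type v) :
    MulAction (Equiv.Perm D) (World L D) where
  smul σ ω := ω.restrict σ⁻¹.toEmbedding
  one_smul _ := rfl
  mul_smul σ τ ω := by
    change ω.restrict (σ * τ)⁻¹.toEmbedding =
      (ω.restrict τ⁻¹.toEmbedding).restrict σ⁻¹.toEmbedding
    rw [World.restrict_trans, mul_inv_rev]
    rfl

/-- The world with all atoms with more than `g` elements made false. -/
def World.truncate (g : ℕ) (ω : World L D) : World L D :=
  fun R a => ω R a ∧ (Set.range a).ncard ≤ g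

theorem World.truncate_eq_iff {g : ℕ} {ω ω' : World L D} :
    ω'.truncate g = ω.truncate g ↔ ω' ∈ agree {x | (Set.range x.2).ncard ≤ g} ω := by
  constructor
  · intro h x hx
    have := iff_of_eq (congrFun (congrFun h x.1) x.2)
    simp only [World.truncate] at this
    exact ⟨fun h' => (this.1 ⟨h', hx⟩).1, fun h' => (this.2 ⟨h', hx⟩).1⟩
  · intro h
    funext R a
    exact propext (and_congr_left fun ha => h ⟨R, a⟩ ha)

theorem World.truncate_truncate (g : ℕ) (ω : World L D) :
    (ω.truncate g).truncate g = ω.truncate g := by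
  funext R a
  simp only [World.truncate, and_assoc, and_self]

theorem World.truncate_restrict {A : Type v} (ι : A ↪ D) (g : ℕ) (ω : World L D) :
    (ω.restrict ι).truncate g = (ω.truncate g).restrict ι := by
  funext R a
  have : (Set.range fun k => ι (a k)) = ι '' Set.range a := by rw [← Set.range_comp]; rfl
  simp only [World.truncate, World.restrict, this, Set.ncard_image_of_injective _ ι.injective]

/-- Truncation selects a canonical member of each trace. This turns traces into values of an
idempotent map commuting with permutations, the form needed by `exists_sampler`. -/
theorem trace_eq_iff {g : ℕ} {ω ω' : World L D} :
    trace g ω' = trace g ω ↔ ω'.truncate g = ω.truncate g := by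
  have h : ∀ ω : World L D, trace g ω = {ω'' | ω''.truncate g = ω.truncate g} := fun ω => by
    ext ω''
    rw [mem_trace_iff, ← World.truncate_eq_iff, Set.mem_ofPred_eq]
  rw [h, h]
  constructor
  · intro h'
    have : ω' ∈ {ω'' | ω''.truncate g = ω.truncate g} := h' ▸ rfl
    exact this
  · intro h'
    rw [h']

theorem World.truncate_eq_self {g : ℕ} [Finite D] (hD : Nat.card D ≤ g) (ω : World L D) :
    ω.truncate g = ω := by
  funext R a
  refine propext (and_iff_left ?_)
  have := Set.ncard_le_ncard (Set.subset_univ (Set.range a))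
  rw [Set.ncard_univ] at this
  exact this.trans hD

/-- If `P` is not essentially asymmetric, the conditional distribution of a world on `g + 1`
elements given its `g`-ary trace can be sampled equivariantly with finitely many coins for every
enumeration of the domain. -/
theorem ProjectiveFamily.exists_world_sampler (P : ProjectiveFamily.{u, v} L)
    (hsym : ¬ P.EssentiallyAsymmetric) (g : ℕ) (K : Type v) [Finite K] (hK : Nat.card K = g + 1) :
    ∃ (N : ℕ) (w : Fin N → Set.Ioo (0 : ℝ) 1)
      (F : (Fin N × Equiv.Perm K → Prop) → World L K → World L K),
      (∀ (σ : Equiv.Perm K) b ω, F (fun i => b (i.1, σ * i.2)) (ω.restrict σ.toEmbedding) =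
        (F b ω).restrict σ.toEmbedding) ∧
      (∀ b ω, F b (ω.truncate g) = F b ω) ∧ (∀ b ω, (F b ω).truncate g = ω.truncate g) ∧
      ∀ ω, coinProb (fun i : Fin N × Equiv.Perm K => w i.1) {b | F b ω = ω} *
        mass (P.weight K) (agree {x | (Set.range x.2).ncard ≤ g} ω) = P.weight K ω := by
  let _ := World.permAction L K
  have hsmul : ∀ (σ : Equiv.Perm K) (ω : World L K), σ • ω = ω.restrict σ⁻¹.toEmbedding :=
    fun _ _ => rfl
  have hfib : ∀ ω : World L K, {x | World.truncate g x = World.truncate g ω} =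
      agree {x | (Set.range x.2).ncard ≤ g} ω := fun ω => by
    ext x
    rw [← World.truncate_eq_iff]
    rfl
  obtain ⟨N, w, F, h1, h2, h3, h4⟩ := exists_sampler (G := Equiv.Perm K) (World.truncate (L := L) g)
    (World.truncate_truncate g) (fun σ ω => World.truncate_restrict _ _ _) (P.weight K)
    P.weight_nonneg
    (fun σ ω => by
      have := P.mass_restrict σ.toEmbedding {ω}
      rw [mass_singleton] at this
      rw [← this, ← mass_singleton (f := P.weight K)]
      congr 1
      ext ω'
      rw [Set.mem_singleton_iff, Set.mem_preimage, Set.mem_singleton_iff, ← inv_smul_eq_iff, hsmul,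
        inv_inv])
    (mass_toReal_univ _).le
    (fun ω => by
      by_cases hpos : 0 < mass (P.weight K) {x | World.truncate g x = World.truncate g ω}
      · rw [hfib, ← trace_eq_agree] at hpos
        have hprob : 0 < prob (P.law K) (trace g ω) := by
          have := toReal_prob (P.law K) (trace g ω)
          exact (ENNReal.toReal_pos_iff.1 (this.trans_gt hpos)).1
        -- The only use of the failure of essential asymmetry: a trace of positive mass has a
        -- symmetric extension `z` of positive weight.
        have hne : prob (P.law K) ({ω | IsSymmetricExtension g ω} ∩ trace g ω) ≠ 0 := by
          intro h0
          refine hsym ⟨g, K, inferInstance, ω, hK, hprob, ?_⟩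
          rw [condProb, h0, ENNReal.zero_div]
        obtain ⟨z, ⟨hz, hzt⟩, hzs⟩ : ∃ z ∈ {ω | IsSymmetricExtension g ω} ∩ trace g ω,
            z ∈ (P.law K).support := by
          by_contra hcon
          push Not at hcon
          apply hne
          rw [prob, PMF.toOuterMeasure_apply_eq_zero_iff, Set.disjoint_left]
          exact fun z hz hz' => hcon z hz' hz
        have hzω : z.truncate g = ω.truncate g := World.truncate_eq_iff.2 (mem_trace_iff.1 hzt)
        refine ⟨z, hzω, fun σ hσ => ?_, fun _ => ENNReal.toReal_pos
          ((PMF.mem_support_iff _ _).1 hzs) ((P.law K).apply_ne_top z)⟩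
        rw [MulAction.mem_stabilizer_iff, hsmul] at hσ ⊢
        have h := hz σ⁻¹ (trace_eq_iff.2 (by
          rw [World.truncate_restrict, hzω]
          exact hσ))
        -- On g + 1 elements the (g+1)-ary trace determines the world, so `z` itself is fixed.
        rw [trace_eq_iff, World.truncate_eq_self hK.le, World.truncate_eq_self hK.le] at h
        exact h
      -- For a null trace the truncation is symmetric enough, and no positivity is required.
      · exact ⟨ω.truncate g, World.truncate_truncate g ω, le_rfl, fun h => absurd h hpos⟩)
  refine ⟨N, w, F, fun σ b ω => ?_, h2, h3, fun ω => ?_⟩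
  · have := h1 σ⁻¹ b ω
    simp only [hsmul, inv_inv] at this
    exact this
  · rw [← h4 ω, hfib]

/-! ### Assembling a world from local samples -/

/-- A domain with `g + 1` elements. -/
abbrev Standard (g : ℕ) : Type v := ULift.{v} (Fin (g + 1))

theorem card_standard (g : ℕ) : Nat.card (Standard.{v} g) = g + 1 := by
  simp

/-- An equivariant procedure for extending a `g`-ary trace on `g + 1` elements to a world, using
`num g` coins for every enumeration of the domain. -/
structure LocalSampler (L : Signature.{u}) where
  num : ℕ → ℕ
  sample : ∀ g, (Fin (num g) × Equiv.Perm (Standard.{v} g) → Prop) → World L (Standard.{v} g) →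
    World L (Standard.{v} g)
  equivariant : ∀ g (σ : Equiv.Perm (Standard.{v} g)) b ω,
    sample g (fun i => b (i.1, σ * i.2)) (ω.restrict σ.toEmbedding) =
      (sample g b ω).restrict σ.toEmbedding
  sample_truncate : ∀ g b ω, sample g b (ω.truncate g) = sample g b ω
  truncate_sample : ∀ g b ω, (sample g b ω).truncate g = ω.truncate g

namespace LocalSampler

variable {L : Signature.{u}} (S : LocalSampler.{u, v} L) {D : Type v}

/-- The signature of the coins used by a sampler. -/
def coinSig : Signature.{u} where
  Rel := ULift.{u} (Σ g : Fin L.maxArity, Fin (S.num g))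
  arity R := R.down.1 + 1
  arity_pos _ := Nat.succ_pos _

/-- The coins attached to the enumerations of the range of `e`. -/
def coins (g : Fin L.maxArity) (e : Standard.{v} g ↪ D) (χ : World S.coinSig D) :
    Fin (S.num g) × Equiv.Perm (Standard.{v} g) → Prop :=
  fun i => χ ⟨⟨g, i.1⟩⟩ fun k => e (i.2 ⟨k⟩)

/-- Every local structure of `ω` is obtained by sampling with the coins `χ`. -/
def IsSampled (χ : World S.coinSig D) (ω : World L D) : Prop :=
  ∀ (g : Fin L.maxArity) (e : Standard.{v} g ↪ D),
    S.sample g (S.coins g e χ) (ω.restrict e) = ω.restrict e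

variable {S}

theorem IsSampled.restrict {A : Type v} (ι : A ↪ D) {χ : World S.coinSig D} {ω : World L D}
    (h : S.IsSampled χ ω) : S.IsSampled (χ.restrict ι) (ω.restrict ι) :=
  fun g e => h g (e.trans ι)

/-- Re-enumerating by `σ` multiplies the permutation index of the coins by `σ` on the left, which is
the shift in `equivariant`. -/
theorem sample_coins_trans {g : Fin L.maxArity} (σ : Equiv.Perm (Standard.{v} g))
    (e : Standard.{v} g ↪ D) (χ : World S.coinSig D) (ω : World L D) :
    S.sample g (S.coins g (σ.toEmbedding.trans e) χ) (ω.restrict (σ.toEmbedding.trans e)) =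
      (S.sample g (S.coins g e χ) (ω.restrict e)).restrict σ.toEmbedding :=
  S.equivariant g σ (S.coins g e χ) (ω.restrict e)

theorem exists_perm_of_range_eq {A : Type v} {e e' : A ↪ D} (h : Set.range e = Set.range e') :
    ∃ σ : Equiv.Perm A, e' = σ.toEmbedding.trans e := by
  refine ⟨(Equiv.ofInjective e' e'.injective).trans
    ((Equiv.setCongr h.symm).trans (Equiv.ofInjective e e.injective).symm), ?_⟩
  ext a
  have := Equiv.apply_ofInjective_symm e.injective
    (Equiv.setCongr h.symm (Equiv.ofInjective e' e'.injective a))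
  exact this.symm

theorem exists_standard_embedding {g : ℕ} {s : Set D} (hs : s.ncard = g + 1) :
    ∃ e : Standard.{v} g ↪ D, Set.range e = s := by
  have hfin : s.Finite := Set.finite_of_ncard_pos (by omega)
  have := hfin.to_subtype
  have e : Standard.{v} g ≃ s := (Finite.card_eq.1 ((card_standard g).trans hs.symm)).some
  exact ⟨e.toEmbedding.trans (Function.Embedding.subtype _),
    (e.surjective.range_comp Subtype.val).trans Subtype.range_coe⟩

/-- By equivariance, one enumeration of each set suffices. -/
theorem IsSampled.of_range {χ : World S.coinSig D} {ω : World L D}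
    (h : ∀ (g : Fin L.maxArity) (e : Standard.{v} g ↪ D), ∃ e' : Standard.{v} g ↪ D,
      Set.range e' = Set.range e ∧ S.sample g (S.coins g e' χ) (ω.restrict e') = ω.restrict e') :
    S.IsSampled χ ω := by
  intro g e
  obtain ⟨e', hr, he'⟩ := h g e
  obtain ⟨σ, rfl⟩ := exists_perm_of_range_eq hr
  rw [sample_coins_trans, he']
  rfl

/-- Induction on the trace: a sample depends only on the coins and the lower trace, so agreement up
to `n` elements propagates to n + 1. -/
theorem IsSampled.unique {χ : World S.coinSig D} {ω ω' : World L D} (h : S.IsSampled χ ω)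
    (h' : S.IsSampled χ ω') : ω = ω' := by
  have main : ∀ n ≤ L.maxArity, ω.truncate n = ω'.truncate n := by
    intro n
    induction n with
    | zero =>
      intro _
      funext R a
      refine propext (and_congr_left fun ha => ?_)
      rw [nonpos_iff_eq_zero, Set.ncard_eq_zero (Set.finite_range a), Set.range_eq_empty_iff] at ha
      exact ha.elim ⟨0, L.arity_pos R⟩
    | succ n ih =>
      intro hn
      have ih := ih (by omega)
      funext R a
      refine propext (and_congr_left fun ha => ?_)
      rcases ha.lt_or_eq with ha | ha
      · exact World.truncate_eq_iff.1 ih ⟨R, a⟩ (Nat.lt_succ_iff.1 ha)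
      · obtain ⟨e, he⟩ := exists_standard_embedding ha
        have h1 := h ⟨n, hn⟩ e
        have h2 := h' ⟨n, hn⟩ e
        have h3 : (ω.restrict e).truncate n = (ω'.restrict e).truncate n := by
          rw [World.truncate_restrict, World.truncate_restrict, ih]
        rw [← S.sample_truncate] at h1 h2
        have h4 : ω.restrict e = ω'.restrict e := by
          rw [← h1, ← h2, h3]
        choose b hb using fun k => (he ▸ Set.mem_range_self k : a k ∈ Set.range e)
        have hba : (fun k => e (b k)) = a := funext hb
        rw [← hba]
        exact iff_of_eq (congrFun (congrFun h4 R) b)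
  have hall := World.truncate_eq_iff.1 (main _ le_rfl)
  funext R a
  refine propext (hall ⟨R, a⟩ ?_)
  have h1 : (Set.range a).ncard ≤ L.arity R := by
    have := Set.ncard_image_le (f := a) (Set.finite_univ)
    rwa [Set.image_univ, Set.ncard_univ, Nat.card_eq_fintype_card, Fintype.card_fin] at this
  exact h1.trans (Finset.le_sup (f := L.arity) (Finset.mem_univ R))

theorem exists_isSampled (χ : World S.coinSig D) : ∃ ω, S.IsSampled χ ω := by
  have main : ∀ n ≤ L.maxArity, ∃ ω : World L D, ∀ (g : Fin L.maxArity) (_ : g < n)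
      (e : Standard.{v} g ↪ D), S.sample g (S.coins g e χ) (ω.restrict e) = ω.restrict e := by
    intro n
    induction n with
    | zero => exact fun _ => ⟨fun _ _ => False, fun g hg => absurd hg (Nat.not_lt_zero _)⟩
    | succ n ih =>
      intro hn
      obtain ⟨ω, hω⟩ := ih (by omega)
      let G : Fin L.maxArity := ⟨n, hn⟩
      -- Keep the atoms with at most `n` elements, read those with exactly n + 1 from the samples,
      -- and make the others false.
      let ω' : World L D := fun R a => ((Set.range a).ncard ≤ n ∧ ω R a) ∨
        ∃ (e : Standard.{v} n ↪ D) (b : Fin (L.arity R) → Standard.{v} n),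
          Function.Surjective b ∧ (fun k => e (b k)) = a ∧
          S.sample n (S.coins G e χ) (ω.restrict e) R b
      have hrange : ∀ {m : ℕ} (e : Standard.{v} n ↪ D) (b : Fin m → Standard.{v} n),
          Function.Surjective b → Set.range (fun k => e (b k)) = Set.range e := by
        intro m e b hb
        exact hb.range_comp e
      have hncard : ∀ e : Standard.{v} n ↪ D, (Set.range e).ncard = n + 1 := by
        intro e
        rw [← Set.image_univ, Set.ncard_image_of_injective _ e.injective, Set.ncard_univ,
          card_standard]
      have hlow : ω'.truncate n = ω.truncate n := by
        funext R a
        refine propext (and_congr_left fun ha => ?_)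
        simp only [ω']
        constructor
        · rintro (⟨_, h⟩ | ⟨e, b, hb, rfl, _⟩)
          · exact h
          · rw [hrange e b hb, hncard] at ha
            omega
        · exact fun h => Or.inl ⟨ha, h⟩
      have htop : ∀ e : Standard.{v} n ↪ D,
          ω'.restrict e = S.sample n (S.coins G e χ) (ω.restrict e) := by
        intro e
        funext R b
        by_cases hb : Function.Surjective b
        · refine propext ⟨?_, fun h => Or.inr ⟨e, b, hb, rfl, h⟩⟩
          rintro (⟨h, _⟩ | ⟨e', b', hb', heq, h⟩)
          · rw [hrange e b hb, hncard] at h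
            omega
          · have hr : Set.range e = Set.range e' := by
              rw [← hrange e b hb, ← hrange e' b' hb', heq]
            -- Different enumerations of the same set give the same atom, by equivariance.
            obtain ⟨σ, rfl⟩ := exists_perm_of_range_eq hr
            rw [sample_coins_trans (g := G)] at h
            have : (fun k => σ (b' k)) = b := funext fun k => e.injective (congrFun heq k)
            rw [← this]
            exact h
        -- A non-surjective tuple has at most `n` elements, where sampling preserves the given
        -- trace.
        · have hb' : (Set.range b).ncard ≤ n := by
            by_contra hcon
            apply hb
            rw [← Set.range_eq_univ]
            apply Set.eq_of_subset_of_ncard_le (Set.subset_univ _)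
            rw [Set.ncard_univ, card_standard]
            omega
          have h1 : (S.sample n (S.coins G e χ) (ω.restrict e)).truncate n =
              (ω'.restrict e).truncate n := by
            rw [S.truncate_sample, World.truncate_restrict, World.truncate_restrict, hlow]
          exact (propext (World.truncate_eq_iff.1 h1 ⟨R, b⟩ hb')).symm
      refine ⟨ω', fun g hg e => ?_⟩
      rcases (Nat.lt_succ_iff.1 hg).lt_or_eq with hg' | hg'
      · have h1 : ω'.restrict e = ω.restrict e := by
          have h2 : (ω'.restrict e).truncate n = (ω.restrict e).truncate n := by
            rw [World.truncate_restrict, World.truncate_restrict, hlow]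
          have hc : Nat.card (Standard.{v} g) ≤ n := by
            rw [card_standard]
            exact hg'
          rwa [World.truncate_eq_self hc, World.truncate_eq_self hc] at h2
        rw [h1]
        exact hω g hg' e
      · obtain rfl : g = G := Fin.ext hg'
        have h1 : (ω'.restrict e).truncate n = (ω.restrict e).truncate n := by
          rw [World.truncate_restrict, World.truncate_restrict, hlow]
        rw [← S.sample_truncate]
        change S.sample n _ ((ω'.restrict e).truncate n) = _
        rw [h1, S.sample_truncate, htop]
  obtain ⟨ω, hω⟩ := main _ le_rfl
  exact ⟨ω, fun g e => hω g g.2 e⟩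

variable (S) in
/-- The world sampled with given coins. -/
noncomputable def world (χ : World S.coinSig D) : World L D :=
  (exists_isSampled χ).choose

theorem world_eq_iff {χ : World S.coinSig D} {ω : World L D} :
    S.world χ = ω ↔ S.IsSampled χ ω :=
  ⟨fun h => h ▸ (exists_isSampled χ).choose_spec,
    fun h => (exists_isSampled χ).choose_spec.unique h⟩

/-- Being sampled is inherited by subdomains and determines the world; projectivity of the program
rests on this. -/
theorem world_restrict {A : Type v} (ι : A ↪ D) (χ : World S.coinSig D) :
    S.world (χ.restrict ι) = (S.world χ).restrict ι :=
  world_eq_iff.2 ((world_eq_iff.1 rfl).restrict ι)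

end LocalSampler

/-! ### Free families as laws of coins -/

theorem pmf_ext_toReal {α : Type*} {μ ν : PMF α} (h : ∀ x, (μ x).toReal = (ν x).toReal) :
    μ = ν :=
  PMF.ext fun x =>
    (ENNReal.toReal_eq_toReal_iff' (μ.apply_ne_top x) (ν.apply_ne_top x)).1 (h x)

section Free

variable {L : Signature.{u}} {D : Type v}

/-- Worlds are families of truth values indexed by ground atoms. -/
def World.atomEquiv (L : Signature.{u}) (D : Type v) :
    World L D ≃ (((R : L.Rel) × (Fin (L.arity R) → D)) → Prop) :=
  (Equiv.piCurry fun _ _ => Prop).symm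

/-- The law of a world whose ground atoms `R(a)` are independently true with probability `w R`. -/
noncomputable def freeLaw (w : L.Rel → Set.Ioo (0 : ℝ) 1) (D : Type v) [Finite D] :
    PMF (World L D) :=
  letI := Fintype.ofFinite (World L D)
  PMF.ofFintype (fun ω => ENNReal.ofReal (coinWeight (fun x => w x.1) (World.atomEquiv L D ω))) (by
    rw [← ENNReal.ofReal_sum_of_nonneg fun ω _ => (coinWeight_pos _ _).le, ← mass_univ,
      ENNReal.ofReal_eq_one]
    exact (mass_preimage_equiv (World.atomEquiv L D) _ Set.univ).trans (coinProb_univ _))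

theorem toReal_freeLaw (w : L.Rel → Set.Ioo (0 : ℝ) 1) [Finite D] (ω : World L D) :
    (freeLaw w D ω).toReal = coinWeight (fun x => w x.1) (World.atomEquiv L D ω) :=
  ENNReal.toReal_ofReal (coinWeight_pos _ _).le

theorem mass_freeLaw (w : L.Rel → Set.Ioo (0 : ℝ) 1) [Finite D]
    (A : Set (((R : L.Rel) × (Fin (L.arity R) → D)) → Prop)) :
    mass (fun ω => (freeLaw w D ω).toReal) (World.atomEquiv L D ⁻¹' A) =
      coinProb (fun x : (R : L.Rel) × (Fin (L.arity R) → D) => w x.1) A := by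
  simp_rw [toReal_freeLaw]
  exact mass_preimage_equiv (World.atomEquiv L D) (coinWeight fun x => w x.1) A

/-- Atoms are mapped injectively by embeddings of domains. -/
theorem mapAtom_injective {A : Type v} (ι : A ↪ D) :
    Function.Injective fun x : (R : L.Rel) × (Fin (L.arity R) → A) =>
      (⟨x.1, fun k => ι (x.2 k)⟩ : (R : L.Rel) × (Fin (L.arity R) → D)) := by
  rintro ⟨R, a⟩ ⟨R', a'⟩ h
  obtain ⟨rfl, h⟩ := Sigma.mk.inj h
  have h := eq_of_heq h
  congr 1
  exact funext fun k => ι.injective (congrFun h k)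

/-- The free family with weights `w`. -/
noncomputable def freeFamily (w : L.Rel → Set.Ioo (0 : ℝ) 1) : ProjectiveFamily.{u, v} L where
  law D _ := freeLaw w D
  projective {A B} _ _ ι := by
    refine pmf_ext_toReal fun ω => ?_
    have h1 := mass_toReal_map (freeLaw w B) (World.restrict ι) {ω}
    rw [mass_singleton] at h1
    rw [h1, toReal_freeLaw]
    have h2 := coinProb_comp_eq (fun x : (R : L.Rel) × (Fin (L.arity R) → B) => w x.1) _
      (mapAtom_injective ι) (World.atomEquiv L A ω)
    refine Eq.trans ?_ h2
    rw [← mass_freeLaw]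
    congr 1
    ext ω'
    rw [Set.mem_preimage, Set.mem_singleton_iff, ← (World.atomEquiv L A).apply_eq_iff_eq]
    rfl

theorem freeFamily_isFree (w : L.Rel → Set.Ioo (0 : ℝ) 1) : (freeFamily.{u, v} w).IsFree := by
  classical
  refine ⟨w, fun D _ ω => ?_⟩
  change ENNReal.ofReal _ = _
  rw [coinWeight_eq_prod, ENNReal.ofReal_prod_of_nonneg, Fintype.prod_sigma, freeWeight]
  · refine Finset.prod_congr rfl fun R _ => ?_
    congr! 1 with a
    change ENNReal.ofReal (if ω R a then _ else _) = _
    split_ifs <;> rfl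
  · intro x _
    have := (w x.1).2
    split_ifs
    · exact this.1.le
    · linarith [this.2]

end Free

/-! ### The law of the sampled world, and the program -/

namespace LocalSampler

variable {L : Signature.{u}} (S : LocalSampler.{u, v} L) {D : Type v}

/-- The coin biases, as weights of the symbols of the coin signature. -/
def coinBias (w : ∀ g, Fin (S.num g) → Set.Ioo (0 : ℝ) 1) (R : S.coinSig.Rel) :
    Set.Ioo (0 : ℝ) 1 :=
  w R.down.1 R.down.2

/-- The coin attached to an enumeration of the range of `e`, as an atom. -/
def coinAtom (g : Fin L.maxArity) (e : Standard.{v} g ↪ D)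
    (i : Fin (S.num g) × Equiv.Perm (Standard.{v} g)) :
    (R : S.coinSig.Rel) × (Fin (S.coinSig.arity R) → D) :=
  ⟨⟨⟨g, i.1⟩⟩, fun k => e (i.2 ⟨k⟩)⟩

theorem range_coinAtom (g : Fin L.maxArity) (e : Standard.{v} g ↪ D)
    (i : Fin (S.num g) × Equiv.Perm (Standard.{v} g)) :
    Set.range (S.coinAtom g e i).2 = Set.range e := by
  have h : Function.Surjective fun k : Fin (g + 1) => i.2 ⟨k⟩ :=
    i.2.surjective.comp ULift.up_surjective
  exact h.range_comp e

theorem coinAtom_injective (g : Fin L.maxArity) (e : Standard.{v} g ↪ D) :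
    Function.Injective (S.coinAtom g e) := by
  rintro ⟨i, σ⟩ ⟨i', σ'⟩ h
  obtain ⟨h1, h2⟩ := Sigma.mk.inj h
  obtain rfl : i = i' := eq_of_heq (Sigma.mk.inj (ULift.up.inj h1)).2
  have h2 := eq_of_heq h2
  congr 1
  ext1 k
  exact e.injective (congrFun h2 k.down)

/-- A sampler with the correct conditional probabilities reproduces a family that satisfies the
strong independence principle. -/
theorem map_world_freeLaw {P : ProjectiveFamily.{u, v} L} (hP : P.SIP)
    (w : ∀ g, Fin (S.num g) → Set.Ioo (0 : ℝ) 1)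
    (hw : ∀ g ω, coinProb (fun i : Fin (S.num g) × Equiv.Perm (Standard.{v} g) => w g i.1)
      {b | S.sample g b ω = ω} *
        mass (P.weight (Standard.{v} g)) (agree {x | (Set.range x.2).ncard ≤ g} ω) =
      P.weight (Standard.{v} g) ω) [Finite D] :
    (freeLaw (S.coinBias w) D).map S.world = P.law D := by
  classical
  have := Fintype.ofFinite D
  refine pmf_ext_toReal fun ω => ?_
  let I := {E : Finset D // 0 < E.card ∧ E.card ≤ L.maxArity}
  have hex : ∀ E : Finset D, 0 < E.card →
      ∃ e : Standard.{v} (E.card - 1) ↪ D, Set.range e = E := fun E hE =>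
    exists_standard_embedding (by rw [Set.ncard_coe_finset]; omega)
  choose e he using hex
  -- The probability that sampling on `E` reproduces `ω`; the value at the empty set is irrelevant,
  -- since the chain rule omits that set.
  let q : Finset D → ℝ := fun E => if h : 0 < E.card then
    coinProb (fun i : Fin (S.num (E.card - 1)) × Equiv.Perm (Standard.{v} (E.card - 1)) =>
        w (E.card - 1) i.1)
      {b | S.sample _ b (ω.restrict (e E h)) = ω.restrict (e E h)} else 1
  have hagree : ∀ (E : Finset D) (h : 0 < E.card) (n : ℕ),
      mass (P.weight D) (agree {x | Set.range x.2 ⊆ E ∧ (Set.range x.2).ncard ≤ n} ω) =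
      mass (P.weight _) (agree {x | (Set.range x.2).ncard ≤ n} (ω.restrict (e E h))) := by
    intro E h n
    rw [← P.mass_restrict (e E h)]
    congr 1
    ext ω'
    rw [Set.mem_preimage, restrict_mem_agree_ncard_le_iff, he E h]
  have hchain := hP.weight_eq_prod ω q fun E h _ => by
    have h1 : {x : (R : L.Rel) × (Fin (L.arity R) → D) | Set.range x.2 ⊆ E} =
        {x | Set.range x.2 ⊆ E ∧ (Set.range x.2).ncard ≤ E.card} := by
      ext x
      refine ⟨fun hx => ⟨hx, ?_⟩, fun hx => hx.1⟩
      have := Set.ncard_le_ncard hx E.finite_toSet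
      rwa [Set.ncard_coe_finset] at this
    have h2 : {x : (R : L.Rel) × (Fin (L.arity R) → D) |
        Set.range x.2 ⊆ E ∧ (Set.range x.2).ncard < E.card} =
        {x | Set.range x.2 ⊆ E ∧ (Set.range x.2).ncard ≤ E.card - 1} := by
      ext x
      simp only [Set.mem_ofPred_eq]
      refine and_congr_right fun _ => ?_
      omega
    have h3 : agree {x | (Set.range x.2).ncard ≤ E.card} (ω.restrict (e E h)) =
        {ω.restrict (e E h)} := by
      ext ω'
      have hc : Nat.card (Standard.{v} (E.card - 1)) ≤ E.card := by
        rw [card_standard]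
        omega
      rw [← World.truncate_eq_iff, World.truncate_eq_self hc, World.truncate_eq_self hc,
        Set.mem_singleton_iff]
    rw [h1, h2, hagree E h, hagree E h, h3, mass_singleton, ← hw]
    simp only [q, h, dif_pos]
  let G : I → Fin L.maxArity := fun E => ⟨E.1.card - 1, by have := E.2; omega⟩
  let e' : ∀ E : I, Standard.{v} (G E) ↪ D := fun E => e E.1 E.2.1
  have he' : ∀ E : I, Set.range (e' E) = E.1 := fun E => he E.1 E.2.1
  let J : (Σ E : I, Fin (S.num (G E)) × Equiv.Perm (Standard.{v} (G E))) →
      (R : S.coinSig.Rel) × (Fin (S.coinSig.arity R) → D) := fun x =>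
    S.coinAtom (G x.1) (e' x.1) x.2
  -- A coin atom has as its range the set it serves, so different sets use disjoint coins.
  have hJ : Function.Injective J := by
    rintro ⟨E, i⟩ ⟨E', i'⟩ h
    have h1 : Set.range (S.coinAtom (G E) (e' E) i).2 =
        Set.range (S.coinAtom (G E') (e' E') i').2 :=
      congrArg (fun x : (R : S.coinSig.Rel) × (Fin (S.coinSig.arity R) → D) => Set.range x.2) h
    rw [range_coinAtom, range_coinAtom, he', he'] at h1
    obtain rfl : E = E' := Subtype.ext (Finset.coe_injective h1)
    exact congrArg (Sigma.mk E) (S.coinAtom_injective (G E) (e' E) h)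
  have hevent : ∀ χ : World S.coinSig D, S.world χ = ω ↔ World.atomEquiv _ D χ ∘ J ∈
      {x | ∀ E : I, (fun j => x ⟨E, j⟩) ∈
        {b | S.sample (G E) b (ω.restrict (e' E)) = ω.restrict (e' E)}} := by
    intro χ
    rw [world_eq_iff]
    constructor
    · exact fun h E => h (G E) (e' E)
    · intro h
      refine IsSampled.of_range fun g f => ?_
      have hc : (Set.range f).ncard = g + 1 := by
        rw [← Set.image_univ, Set.ncard_image_of_injective _ f.injective, Set.ncard_univ,
          card_standard]
      obtain ⟨E, hE⟩ : ∃ E : Finset D, (E : Set D) = Set.range f :=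
        ⟨(Set.range f).toFinite.toFinset, by simp⟩
      rw [← hE, Set.ncard_coe_finset] at hc
      have hEI : 0 < E.card ∧ E.card ≤ L.maxArity := by have := g.2; omega
      obtain rfl : G ⟨E, hEI⟩ = g := Fin.ext (by simp [G, hc])
      exact ⟨e' ⟨E, hEI⟩, (he' ⟨E, hEI⟩).trans hE, h ⟨E, hEI⟩⟩
  have h1 := mass_toReal_map (freeLaw (S.coinBias w) D) S.world {ω}
  rw [mass_singleton] at h1
  have h2 : S.world ⁻¹' {ω} = World.atomEquiv S.coinSig D ⁻¹' {x | x ∘ J ∈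
      {x | ∀ E : I, (fun j => x ⟨E, j⟩) ∈
        {b | S.sample (G E) b (ω.restrict (e' E)) = ω.restrict (e' E)}}} := by
    ext χ
    exact hevent χ
  -- Forget the unused coins, then factor over the sets `E`; the result is the product in the chain
  -- rule.
  rw [h1, h2, mass_freeLaw, coinProb_comp _ J hJ, coinProb_sigma]
  refine Eq.trans ?_ hchain.symm
  rw [Finset.prod_subtype (p := fun E : Finset D => 0 < E.card ∧ E.card ≤ L.maxArity) _ (by simp)
    q]
  refine Finset.prod_congr rfl fun E _ => ?_
  simp only [q, E.2.1, dif_pos]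
  rfl

/-- The union of a signature with the coin signature. -/
def totalSig : Signature.{u} where
  Rel := L.Rel ⊕ S.coinSig.Rel
  arity := Sum.elim L.arity S.coinSig.arity
  arity_pos R := by
    cases R
    · exact L.arity_pos _
    · exact S.coinSig.arity_pos _

/-- The original signature as a subsignature of the total one. -/
def inclLeft : Inclusion L S.totalSig := ⟨Sum.inl, Sum.inl_injective, fun _ => rfl⟩

/-- The coin signature as a subsignature of the total one. -/
def inclRight : Inclusion S.coinSig S.totalSig := ⟨Sum.inr, Sum.inr_injective, fun _ => rfl⟩

/-- The expansion of a world for the coin signature by the sampled world. -/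
noncomputable def expand (χ : World S.coinSig D) : World S.totalSig D
  | Sum.inl R => S.world χ R
  | Sum.inr R => χ R

theorem expand_restrict {A : Type v} (ι : A ↪ D) (χ : World S.coinSig D) :
    S.expand (χ.restrict ι) = (S.expand χ).restrict ι := by
  funext R
  cases R with
  | inl R => exact congrFun (world_restrict ι χ) R
  | inr R => rfl

/-- The generalised probabilistic logic program that samples a world from coins. -/
noncomputable def program (w : ∀ g, Fin (S.num g) → Set.Ioo (0 : ℝ) 1) :
    GeneralisedPLP.{u, v} S.totalSig where
  freeSig := S.coinSig
  incl := S.inclRight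
  freeFamily := freeFamily (S.coinBias w)
  isFree := freeFamily_isFree _
  expand _ _ := S.expand
  expands _ _ _ := rfl

theorem program_isProjective (w : ∀ g, Fin (S.num g) → Set.Ioo (0 : ℝ) 1) :
    (S.program w).IsProjective := by
  intro A B _ _ ι
  change (((freeFamily (S.coinBias w)).law B).map S.expand).map (World.restrict ι) =
    ((freeFamily (S.coinBias w)).law A).map S.expand
  rw [← (freeFamily (S.coinBias w)).projective ι, PMF.map_comp, PMF.map_comp]
  congr 1
  funext χ
  exact (S.expand_restrict ι χ).symm

end LocalSampler

end PLP

theorem mainTheorem2 {L : PLP.Signature.{u}} (P : PLP.ProjectiveFamily.{u, v} L)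
    (hSIP : P.SIP) (hsym : ¬ P.EssentiallyAsymmetric) :
    ∃ (L₁ : PLP.Signature.{u}) (i : PLP.Inclusion L L₁) (Q : PLP.GeneralisedPLP.{u, v} L₁),
      Q.IsProjective ∧ P.IsReductOf i Q := by
  choose N w F h1 h2 h3 h4 using fun g =>
    P.exists_world_sampler hsym g (PLP.Standard.{v} g) (PLP.card_standard g)
  let S : PLP.LocalSampler.{u, v} L := ⟨N, F, h1, h2, h3⟩
  refine ⟨S.totalSig, S.inclLeft, S.program w, S.program_isProjective w, fun D _ => ?_⟩
  rw [← S.map_world_freeLaw hSIP w h4]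
  change _ = ((PLP.freeLaw (S.coinBias w) D).map S.expand).map (PLP.World.reduct S.inclLeft)
  rw [PMF.map_comp]
  rfl
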